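/- Conventions. Let $k$ be an algebraically closed field. A finite category is a $k$-linear abelian category that is $k$-linearly equivalent to the category of finite-dimensional modules over a finite-dimensional $k$-algebra. A finite tensor category is a finite category with a rigid monoidal structure whose tensor product is $k$-bilinear and with $\mathrm{End}(\mathbf 1)=k$. The right dual $a^\vee$ of $a$ has morphisms $a^\vee\otimes a\to\mathbf 1$ and $\mathbf 1\to a\otimes a^\vee$, the left dual ${}^\vee a$ has morphisms $a\otimes{}^\vee a\to\mathbf 1$ and $\mathbf 1\to{}^\vee a\otimes a$; the double duals $a\mapsto a^{\vee\vee}$ and $b\mapsto{}^{\vee\vee}b$ are monoidal functors in the canonical way. For finite tensor categories $\mathcal A$ and $\mathcal B$, an $\mathcal A$-$\mathcal B$-bimodule category is a finite category $\mathcal M$ with a left action of $\mathcal A$ and a right action of $\mathcal B$ (both $k$-bilinear, exact in the variable in $\mathcal A$ and $\mathcal B$, respectively, with coherent associativity and unit constraints) and with natural isomorphisms $(a.m).b\cong a.(m.b)$ that satisfy the two pentagon relations. Let ${}^{\vee\vee}\!\mathcal M^{\vee\vee}$ denote the category $\mathcal M$ with the bimodule structure in which $a$ acts as $a^{\vee\vee}$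 from the left and $b$ acts as ${}^{\vee\vee}b$ from the right. For a finite-dimensional vector space $V$ and $x\in\mathcal M$, let $V\otimes x$ be the object with $\mathrm{Hom}(V\otimes x,y)\cong\mathrm{Hom}_k(V,\mathrm{Hom}(x,y))$. Theorem 4.2 (Radford theorem for finite bimodule categories). Let $\mathcal A$ and $\mathcal B$ be finite tensor categories and $\mathcal M$ an $\mathcal A$-$\mathcal B$-bimodule category. For every $m\in\mathcal M$ the end $$N^l_{\mathcal M}(m)=\int_{x\in\mathcal M}\mathrm{Hom}_{\mathcal M}(x,m)\otimes x$$ exists, and (for every choice of these ends) the resulting functor $N^l_{\mathcal M}\colon\mathcal M\to\mathcal M$ is $k$-linear and has a canonical structure of a bimodule functor $$N^l_{\mathcal M}\colon\ \mathcal M\to{}^{\vee\vee}\!\mathcal M^{\vee\vee}.$$ That is, there are isomorphisms, natural in all variables, $$N^l_{\mathcal M}(a.m)\cong a^{\vee\vee}.N^l_{\mathcal M}(m),\qquad N^l_{\mathcal M}(m.b)\cong N^l_{\mathcal M}(m).{}^{\vee\vee}b\qquad(a\in\mathcal A,\ m\in\mathcal M,\ b\in\mathcal B),$$ that obey the axioms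 of a left and of a right module functor and are compatible with the isomorphisms $(a.m).b\cong a.(m.b)$; in particular $N^l_{\mathcal M}(a.m.b)\cong a^{\vee\vee}.N^l_{\mathcal M}(m).{}^{\vee\vee}b$ coherently. The structure is canonical in the following sense. Write $p^m_x\colon N^l_{\mathcal M}(m)\to\mathrm{Hom}(x,m)\otimes x$ for the structure morphisms of the ends. Then for all $a\in\mathcal A$ and $m,x\in\mathcal M$ the composite $$N^l_{\mathcal M}(a.m)\cong a^{\vee\vee}.N^l_{\mathcal M}(m)\xrightarrow{\ a^{\vee\vee}.\,p^m_x\ }a^{\vee\vee}.(\mathrm{Hom}(x,m)\otimes x)$$ is equal to the composite $$N^l_{\mathcal M}(a.m)\xrightarrow{\ p^{a.m}_{a^{\vee\vee}.x}\ }\mathrm{Hom}(a^{\vee\vee}.x,a.m)\otimes(a^{\vee\vee}.x)\to\mathrm{Hom}(x,m)\otimes(a^{\vee\vee}.x)\cong a^{\vee\vee}.(\mathrm{Hom}(x,m)\otimes x),$$ where the linear map $\mathrm{Hom}(a^{\vee\vee}.x,a.m)\to\mathrm{Hom}(x,m)$ sends $f$ to $x\to a^\vee.(a^{\vee\vee}.x)\xrightarrow{a^\vee.f}a^\vee.(a.m)\to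 m$, with the first and last arrow given by the coevaluation $\mathbf 1\to a^\vee\otimes a^{\vee\vee}$ and the evaluation $a^\vee\otimes a\to\mathbf 1$; and the isomorphisms for $b\in\mathcal B$ satisfy the analogous condition, with $\mathrm{Hom}(x.{}^{\vee\vee}b,m.b)\to\mathrm{Hom}(x,m)$, $f\mapsto\big(x\to(x.{}^{\vee\vee}b).{}^\vee b\xrightarrow{f.{}^\vee b}(m.b).{}^\vee b\to m\big)$. -/

import Mathlib

open CategoryTheory MonoidalCategory Limits
open scoped MonoidalLeftAction MonoidalRightAction

set_option linter.unusedSimpArgs false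

namespace FinTensor

section RightMates

universe v u
variable {C : Type u} [Category.{v} C] [MonoidalCategory C]

/-- The transpose `Y' ⟶ X'` of `f : X ⟶ Y` for a right dual `X'` of `X` and a right dual `Y'`
of `Y`. -/
def rightMate {X X' Y Y' : C} (p : ExactPairing X X') (q : ExactPairing Y Y') (f : X ⟶ Y) :
    Y' ⟶ X' :=
  @rightAdjointMate C _ _ X Y (@HasRightDual.mk _ _ _ X X' p) (@HasRightDual.mk _ _ _ Y Y' q) f

lemma rightMate_id {X X' : C} (p : ExactPairing X X') : rightMate p p (𝟙 X) = 𝟙 X' :=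
  @rightAdjointMate_id C _ _ X (@HasRightDual.mk _ _ _ X X' p)

lemma rightMate_comp {X X' Y Y' Z Z' : C} (p : ExactPairing X X') (q : ExactPairing Y Y')
    (r : ExactPairing Z Z') (f : X ⟶ Y) (g : Y ⟶ Z) :
    rightMate p r (f ≫ g) = rightMate q r g ≫ rightMate p q f :=
  @comp_rightAdjointMate C _ _ X Y Z (@HasRightDual.mk _ _ _ X X' p)
    (@HasRightDual.mk _ _ _ Y Y' q) (@HasRightDual.mk _ _ _ Z Z' r) f g

lemma rightMate_evaluation {X X' Y Y' : C} (p : ExactPairing X X') (q : ExactPairing Y Y')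
    (f : X ⟶ Y) : rightMate p q f ▷ X ≫ ε_ X X' = Y' ◁ f ≫ ε_ Y Y' :=
  @rightAdjointMate_comp_evaluation C _ _ X Y (@HasRightDual.mk _ _ _ X X' p)
    (@HasRightDual.mk _ _ _ Y Y' q) f

lemma eq_rightMate {X X' Y Y' : C} (p : ExactPairing X X') (q : ExactPairing Y Y')
    (f : X ⟶ Y) (g : Y' ⟶ X') (h : g ▷ X ≫ ε_ X X' = Y' ◁ f ≫ ε_ Y Y') :
    rightMate p q f = g := by
  rw [← rightMate_evaluation p q f] at h
  have h' := congrArg (fun t => Y' ◁ η_ X X' ≫ (α_ _ _ _).inv ≫ t ▷ X' ≫ (λ_ X').hom) h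
  have key : ∀ t : Y' ⟶ X', Y' ◁ η_ X X' ≫ (α_ _ _ _).inv ≫ (t ▷ X ≫ ε_ X X') ▷ X' ≫
      (λ_ X').hom = (ρ_ Y').hom ≫ t := by
    intro t
    calc
      _ = 𝟙 _ ⊗≫ (Y' ◁ η_ X X' ≫ t ▷ (X ⊗ X')) ⊗≫ ε_ X X' ▷ X' ⊗≫ 𝟙 _ := by monoidal
      _ = 𝟙 _ ⊗≫ t ▷ 𝟙_ C ⊗≫ (X' ◁ η_ X X' ⊗≫ ε_ X X' ▷ X') ⊗≫ 𝟙 _ := by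
        rw [whisker_exchange]; monoidal
      _ = _ := by
        rw [ExactPairing.coevaluation_evaluation'']; monoidal
  simp only [key] at h'
  exact ((cancel_epi _).1 h').symm

lemma rightMate_tensor {X X' Y Y' Z Z' W W' : C} (p : ExactPairing X X') (q : ExactPairing Y Y')
    (r : ExactPairing Z Z') (s : ExactPairing W W') (f : X ⟶ Z) (g : Y ⟶ W) :
    rightMate (ExactPairing.tensor (X₁ := X) (X₂ := Y)) (ExactPairing.tensor (X₁ := Z) (X₂ := W))
      (f ⊗ₘ g) = rightMate q s g ⊗ₘ rightMate p r f := by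
  apply eq_rightMate
  rw [ExactPairing.tensor_evaluation, ExactPairing.tensor_evaluation]
  have hf := rightMate_evaluation p r f
  have hg := rightMate_evaluation q s g
  generalize rightMate p r f = f' at *
  generalize rightMate q s g = g' at *
  calc
    _ = 𝟙 _ ⊗≫ g' ▷ (Z' ⊗ X ⊗ Y) ⊗≫ Y' ◁ (f' ▷ X ≫ ε_ X X') ▷ Y ⊗≫ ε_ Y Y' := by
      rw [MonoidalCategory.tensorHom_def]; monoidal
    _ = 𝟙 _ ⊗≫ (g' ▷ (Z' ⊗ X ⊗ Y) ≫ Y' ◁ (Z' ◁ f ▷ Y)) ⊗≫ Y' ◁ ε_ Z Z' ▷ Y ⊗≫ ε_ Y Y' := by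
      rw [hf]; monoidal
    _ = 𝟙 _ ⊗≫ W' ◁ (Z' ◁ f ▷ Y) ⊗≫ (g' ▷ ((Z' ⊗ Z) ⊗ Y) ≫ Y' ◁ (ε_ Z Z' ▷ Y)) ⊗≫ ε_ Y Y' := by
      rw [← whisker_exchange]; monoidal
    _ = 𝟙 _ ⊗≫ W' ◁ (Z' ◁ f ▷ Y) ⊗≫ W' ◁ (ε_ Z Z' ▷ Y) ⊗≫ (g' ▷ Y ≫ ε_ Y Y') := by
      rw [← whisker_exchange]; monoidal
    _ = 𝟙 _ ⊗≫ W' ◁ (Z' ◁ f ▷ Y) ⊗≫ W' ◁ (ε_ Z Z' ▷ Y ≫ (𝟙_ C) ◁ g) ⊗≫ ε_ W W' := by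
      rw [hg]; monoidal
    _ = _ := by
      rw [← whisker_exchange, MonoidalCategory.tensorHom_def]; monoidal

lemma rightMate_associator {X X' Y Y' Z Z' : C} (p : ExactPairing X X') (q : ExactPairing Y Y')
    (r : ExactPairing Z Z') :
    rightMate (ExactPairing.tensor (X₁ := X ⊗ Y) (X₂ := Z) (Y₁ := Y' ⊗ X'))
      (ExactPairing.tensor (X₁ := X) (X₂ := Y ⊗ Z) (Y₂ := Z' ⊗ Y')) (α_ X Y Z).hom =
      (α_ Z' Y' X').hom := by
  apply eq_rightMate
  simp only [ExactPairing.tensor_evaluation]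
  monoidal

lemma rightMate_leftUnitor {X X' : C} (p : ExactPairing X X') :
    rightMate (ExactPairing.tensor (X₁ := 𝟙_ C) (X₂ := X) (Y₁ := 𝟙_ C)) p (λ_ X).hom =
      (ρ_ X').inv := by
  apply eq_rightMate
  rw [ExactPairing.tensor_evaluation]
  have : ε_ (𝟙_ C) (𝟙_ C) = (ρ_ (𝟙_ C)).hom := rfl
  rw [this]
  monoidal

lemma rightMate_rightUnitor {X X' : C} (p : ExactPairing X X') :
    rightMate (ExactPairing.tensor (X₁ := X) (X₂ := 𝟙_ C) (Y₂ := 𝟙_ C)) p (ρ_ X).hom =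
      (λ_ X').inv := by
  apply eq_rightMate
  rw [ExactPairing.tensor_evaluation]
  have : ε_ (𝟙_ C) (𝟙_ C) = (ρ_ (𝟙_ C)).hom := rfl
  rw [this]
  monoidal

end RightMates

section LeftMates

universe v u
variable {C : Type u} [Category.{v} C] [MonoidalCategory C]

/-- The transpose `Y' ⟶ X'` of `f : X ⟶ Y` for a left dual `X'` of `X` and a left dual `Y'`
of `Y`. -/
def leftMate {X X' Y Y' : C} (p : ExactPairing X' X) (q : ExactPairing Y' Y) (f : X ⟶ Y) :
    Y' ⟶ X' :=
  @leftAdjointMate C _ _ X Y (@HasLeftDual.mk _ _ _ X X' p) (@HasLeftDual.mk _ _ _ Y Y' q) f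

lemma leftMate_id {X X' : C} (p : ExactPairing X' X) : leftMate p p (𝟙 X) = 𝟙 X' :=
  @leftAdjointMate_id C _ _ X (@HasLeftDual.mk _ _ _ X X' p)

lemma leftMate_comp {X X' Y Y' Z Z' : C} (p : ExactPairing X' X) (q : ExactPairing Y' Y)
    (r : ExactPairing Z' Z) (f : X ⟶ Y) (g : Y ⟶ Z) :
    leftMate p r (f ≫ g) = leftMate q r g ≫ leftMate p q f :=
  @comp_leftAdjointMate C _ _ X Y Z (@HasLeftDual.mk _ _ _ X X' p)
    (@HasLeftDual.mk _ _ _ Y Y' q) (@HasLeftDual.mk _ _ _ Z Z' r) f g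

lemma leftMate_evaluation {X X' Y Y' : C} (p : ExactPairing X' X) (q : ExactPairing Y' Y)
    (f : X ⟶ Y) : X ◁ leftMate p q f ≫ ε_ X' X = f ▷ Y' ≫ ε_ Y' Y :=
  @leftAdjointMate_comp_evaluation C _ _ X Y (@HasLeftDual.mk _ _ _ X X' p)
    (@HasLeftDual.mk _ _ _ Y Y' q) f

lemma eq_leftMate {X X' Y Y' : C} (p : ExactPairing X' X) (q : ExactPairing Y' Y)
    (f : X ⟶ Y) (g : Y' ⟶ X') (h : X ◁ g ≫ ε_ X' X = f ▷ Y' ≫ ε_ Y' Y) :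
    leftMate p q f = g := by
  rw [← leftMate_evaluation p q f] at h
  have h' := congrArg (fun t => η_ X' X ▷ Y' ≫ (α_ _ _ _).hom ≫ X' ◁ t ≫ (ρ_ X').hom) h
  have key : ∀ t : Y' ⟶ X', η_ X' X ▷ Y' ≫ (α_ _ _ _).hom ≫ X' ◁ (X ◁ t ≫ ε_ X' X) ≫
      (ρ_ X').hom = (λ_ Y').hom ≫ t := by
    intro t
    calc
      _ = 𝟙 _ ⊗≫ (η_ X' X ▷ Y' ≫ (X' ⊗ X) ◁ t) ⊗≫ X' ◁ ε_ X' X ⊗≫ 𝟙 _ := by monoidal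
      _ = 𝟙 _ ⊗≫ 𝟙_ C ◁ t ⊗≫ (η_ X' X ▷ X' ⊗≫ X' ◁ ε_ X' X) ⊗≫ 𝟙 _ := by
        rw [← whisker_exchange]; monoidal
      _ = _ := by
        rw [ExactPairing.evaluation_coevaluation'']; monoidal
  simp only [key] at h'
  exact ((cancel_epi _).1 h').symm

lemma leftMate_tensor {X X' Y Y' Z Z' W W' : C} (p : ExactPairing X' X) (q : ExactPairing Y' Y)
    (r : ExactPairing Z' Z) (s : ExactPairing W' W) (f : X ⟶ Z) (g : Y ⟶ W) :
    leftMate (ExactPairing.tensor (Y₂ := X) (Y₁ := Y)) (ExactPairing.tensor (Y₂ := Z) (Y₁ := W))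
      (f ⊗ₘ g) = leftMate q s g ⊗ₘ leftMate p r f := by
  apply eq_leftMate
  rw [ExactPairing.tensor_evaluation, ExactPairing.tensor_evaluation]
  have hf := leftMate_evaluation p r f
  have hg := leftMate_evaluation q s g
  generalize leftMate p r f = f' at *
  generalize leftMate q s g = g' at *
  calc
    _ = 𝟙 _ ⊗≫ (X ⊗ Y ⊗ W') ◁ f' ⊗≫ X ◁ (Y ◁ g' ≫ ε_ Y' Y) ▷ X' ⊗≫ ε_ X' X := by
      rw [MonoidalCategory.tensorHom_def']; monoidal
    _ = 𝟙 _ ⊗≫ ((X ⊗ Y ⊗ W') ◁ f' ≫ (X ◁ (g ▷ W')) ▷ X') ⊗≫ X ◁ ε_ W' W ▷ X' ⊗≫ ε_ X' X := by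
      rw [hg]; monoidal
    _ = 𝟙 _ ⊗≫ (X ◁ (g ▷ W')) ▷ Z' ⊗≫ ((X ⊗ (W ⊗ W')) ◁ f' ≫ (X ◁ ε_ W' W) ▷ X') ⊗≫
        ε_ X' X := by
      rw [whisker_exchange]; monoidal
    _ = 𝟙 _ ⊗≫ (X ◁ (g ▷ W')) ▷ Z' ⊗≫ (X ◁ ε_ W' W) ▷ Z' ⊗≫ (X ◁ f' ≫ ε_ X' X) := by
      rw [whisker_exchange]; monoidal
    _ = 𝟙 _ ⊗≫ (X ◁ (g ▷ W')) ▷ Z' ⊗≫ (X ◁ ε_ W' W ≫ f ▷ (𝟙_ C)) ▷ Z' ⊗≫ ε_ Z' Z := by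
      rw [hf]; monoidal
    _ = _ := by
      rw [whisker_exchange, MonoidalCategory.tensorHom_def']; monoidal

lemma leftMate_associator {X X' Y Y' Z Z' : C} (p : ExactPairing X' X) (q : ExactPairing Y' Y)
    (r : ExactPairing Z' Z) :
    leftMate (ExactPairing.tensor (Y₂ := X ⊗ Y) (Y₁ := Z) (X₂ := Y' ⊗ X'))
      (ExactPairing.tensor (Y₂ := X) (Y₁ := Y ⊗ Z) (X₁ := Z' ⊗ Y')) (α_ X Y Z).hom =
      (α_ Z' Y' X').hom := by
  apply eq_leftMate
  simp only [ExactPairing.tensor_evaluation]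
  monoidal

lemma leftMate_leftUnitor {X X' : C} (p : ExactPairing X' X) :
    leftMate (ExactPairing.tensor (Y₂ := 𝟙_ C) (Y₁ := X) (X₂ := 𝟙_ C)) p (λ_ X).hom =
      (ρ_ X').inv := by
  apply eq_leftMate
  rw [ExactPairing.tensor_evaluation]
  have : ε_ (𝟙_ C) (𝟙_ C) = (ρ_ (𝟙_ C)).hom := rfl
  rw [this]
  monoidal

lemma leftMate_rightUnitor {X X' : C} (p : ExactPairing X' X) :
    leftMate (ExactPairing.tensor (Y₂ := X) (Y₁ := 𝟙_ C) (X₁ := 𝟙_ C)) p (ρ_ X).hom =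
      (λ_ X').inv := by
  apply eq_leftMate
  rw [ExactPairing.tensor_evaluation]
  have : ε_ (𝟙_ C) (𝟙_ C) = (ρ_ (𝟙_ C)).hom := rfl
  rw [this]
  monoidal

end LeftMates

section DoubleDual

universe v u
variable {C : Type u} [Category.{v} C] [MonoidalCategory C]

variable (C) in
/-- An object with a chosen right dual and a chosen right dual of that. -/
structure RightDualTriple where
  obj : C
  dual : C
  ddual : C
  pair : ExactPairing obj dual
  pair' : ExactPairing dual ddual

namespace RightDualTriple

/-- The double transpose of a morphism. -/
def mate (P Q : RightDualTriple C) (f : P.obj ⟶ Q.obj) : P.ddual ⟶ Q.ddual :=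
  rightMate Q.pair' P.pair' (rightMate P.pair Q.pair f)

lemma mate_id (P : RightDualTriple C) : mate P P (𝟙 P.obj) = 𝟙 P.ddual := by
  simp [mate, rightMate_id]

lemma mate_comp (P Q R : RightDualTriple C) (f : P.obj ⟶ Q.obj) (g : Q.obj ⟶ R.obj) :
    mate P R (f ≫ g) = mate P Q f ≫ mate Q R g := by
  simp only [mate]
  rw [rightMate_comp P.pair Q.pair R.pair, rightMate_comp R.pair' Q.pair' P.pair']

/-- The double transpose of an isomorphism. -/
@[simps]
def mateIso (P Q : RightDualTriple C) (f : P.obj ≅ Q.obj) : P.ddual ≅ Q.ddual where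
  hom := mate P Q f.hom
  inv := mate Q P f.inv
  hom_inv_id := by rw [← mate_comp, f.hom_inv_id, mate_id]
  inv_hom_id := by rw [← mate_comp, f.inv_hom_id, mate_id]

/-- The tensor product, with `(X ⊗ Y)ᘁ` chosen to be `Yᘁ ⊗ Xᘁ`. -/
abbrev tensor (P Q : RightDualTriple C) : RightDualTriple C where
  obj := P.obj ⊗ Q.obj
  dual := Q.dual ⊗ P.dual
  ddual := P.ddual ⊗ Q.ddual
  pair := letI := P.pair; letI := Q.pair; ExactPairing.tensor
  pair' := letI := P.pair'; letI := Q.pair'; ExactPairing.tensor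

variable (C) in
/-- The unit, chosen to be its own dual. -/
abbrev unit : RightDualTriple C where
  obj := 𝟙_ C
  dual := 𝟙_ C
  ddual := 𝟙_ C
  pair := exactPairingUnit
  pair' := exactPairingUnit

lemma mate_tensor (P Q R S : RightDualTriple C) (f : P.obj ⟶ R.obj) (g : Q.obj ⟶ S.obj) :
    mate (P.tensor Q) (R.tensor S) (f ⊗ₘ g) = mate P R f ⊗ₘ mate Q S g := by
  have h := rightMate_tensor P.pair Q.pair R.pair S.pair f g
  have h' := rightMate_tensor S.pair' R.pair' Q.pair' P.pair' (rightMate Q.pair S.pair g)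
    (rightMate P.pair R.pair f)
  exact (congrArg _ h).trans h'

lemma mate_associator (P Q R : RightDualTriple C) :
    mate ((P.tensor Q).tensor R) (P.tensor (Q.tensor R)) (α_ P.obj Q.obj R.obj).hom =
      (α_ P.ddual Q.ddual R.ddual).hom := by
  have h := rightMate_associator P.pair Q.pair R.pair
  have h' := rightMate_associator R.pair' Q.pair' P.pair'
  exact (congrArg _ h).trans h'

lemma mate_leftUnitor (P : RightDualTriple C) :
    mate ((unit C).tensor P) P (λ_ P.obj).hom = (λ_ P.ddual).hom := by
  let _ := P.pair'
  have h := rightMate_leftUnitor P.pair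
  have h' := rightMate_rightUnitor P.pair'
  have e : rightMate P.pair' (ExactPairing.tensor (X₁ := P.dual) (X₂ := 𝟙_ C) (Y₂ := 𝟙_ C))
      (ρ_ P.dual).inv = (λ_ P.ddual).hom := by
    rw [← cancel_epi (λ_ P.ddual).inv, Iso.inv_hom_id, ← h', ← rightMate_comp, Iso.inv_hom_id,
      rightMate_id]
  exact (congrArg _ h).trans e

lemma mate_rightUnitor (P : RightDualTriple C) :
    mate (P.tensor (unit C)) P (ρ_ P.obj).hom = (ρ_ P.ddual).hom := by
  let _ := P.pair'
  have h := rightMate_rightUnitor P.pair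
  have h' := rightMate_leftUnitor P.pair'
  have e : rightMate P.pair' (ExactPairing.tensor (X₁ := 𝟙_ C) (X₂ := P.dual) (Y₁ := 𝟙_ C))
      (λ_ P.dual).inv = (ρ_ P.ddual).hom := by
    rw [← cancel_epi (ρ_ P.ddual).inv, Iso.inv_hom_id, ← h', ← rightMate_comp, Iso.inv_hom_id,
      rightMate_id]
  exact (congrArg _ h).trans e

lemma mate_whiskerRight (P Q R : RightDualTriple C) (f : P.obj ⟶ Q.obj) :
    mate (P.tensor R) (Q.tensor R) (f ▷ R.obj) = mate P Q f ▷ R.ddual := by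
  have h := mate_tensor P R Q R f (𝟙 R.obj)
  rwa [mate_id, tensorHom_id, tensorHom_id] at h

lemma mate_whiskerLeft (P Q R : RightDualTriple C) (f : P.obj ⟶ Q.obj) :
    mate (R.tensor P) (R.tensor Q) (R.obj ◁ f) = R.ddual ◁ mate P Q f := by
  have h := mate_tensor R P R Q (𝟙 R.obj) f
  rwa [mate_id, id_tensorHom, id_tensorHom] at h

lemma mate_natural_left (P Q R U V : RightDualTriple C) (f : P.obj ⟶ Q.obj)
    (e : P.obj ⊗ R.obj ⟶ U.obj) (e' : Q.obj ⊗ R.obj ⟶ V.obj) (g : U.obj ⟶ V.obj)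
    (h : f ▷ R.obj ≫ e' = e ≫ g) :
    mate P Q f ▷ R.ddual ≫ mate (Q.tensor R) V e' = mate (P.tensor R) U e ≫ mate U V g := by
  rw [← mate_whiskerRight, ← mate_comp, ← mate_comp]
  exact congrArg _ h

lemma mate_natural_right (P Q R U V : RightDualTriple C) (f : P.obj ⟶ Q.obj)
    (e : R.obj ⊗ P.obj ⟶ U.obj) (e' : R.obj ⊗ Q.obj ⟶ V.obj) (g : U.obj ⟶ V.obj)
    (h : R.obj ◁ f ≫ e' = e ≫ g) :
    R.ddual ◁ mate P Q f ≫ mate (R.tensor Q) V e' = mate (R.tensor P) U e ≫ mate U V g := by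
  rw [← mate_whiskerLeft, ← mate_comp, ← mate_comp]
  exact congrArg _ h

lemma mate_associativity (P Q R U V W W' : RightDualTriple C) (e : P.obj ⊗ Q.obj ⟶ U.obj)
    (g : U.obj ⊗ R.obj ⟶ W.obj) (h : W.obj ⟶ W'.obj) (e' : Q.obj ⊗ R.obj ⟶ V.obj)
    (g' : P.obj ⊗ V.obj ⟶ W'.obj)
    (H : e ▷ R.obj ≫ g ≫ h = (α_ _ _ _).hom ≫ P.obj ◁ e' ≫ g') :
    mate (P.tensor Q) U e ▷ R.ddual ≫ mate (U.tensor R) W g ≫ mate W W' h =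
      (α_ _ _ _).hom ≫ P.ddual ◁ mate (Q.tensor R) V e' ≫ mate (P.tensor V) W' g' := by
  rw [← mate_whiskerRight, ← mate_whiskerLeft, ← mate_associator, ← mate_comp, ← mate_comp,
    ← mate_comp, ← mate_comp, H]

lemma mate_left_unitality (P U V : RightDualTriple C) (e : 𝟙_ C ⟶ U.obj)
    (g : U.obj ⊗ P.obj ⟶ V.obj) (h : V.obj ⟶ P.obj) (H : (λ_ P.obj).hom = e ▷ P.obj ≫ g ≫ h) :
    (λ_ P.ddual).hom = mate (unit C) U e ▷ P.ddual ≫ mate (U.tensor P) V g ≫ mate V P h := by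
  rw [← mate_whiskerRight, ← mate_leftUnitor, ← mate_comp, ← mate_comp, H]

lemma mate_right_unitality (P U V : RightDualTriple C) (e : 𝟙_ C ⟶ U.obj)
    (g : P.obj ⊗ U.obj ⟶ V.obj) (h : V.obj ⟶ P.obj) (H : (ρ_ P.obj).hom = P.obj ◁ e ≫ g ≫ h) :
    (ρ_ P.ddual).hom = P.ddual ◁ mate (unit C) U e ≫ mate (P.tensor U) V g ≫ mate V P h := by
  rw [← mate_whiskerLeft, ← mate_rightUnitor, ← mate_comp, ← mate_comp, H]

/-- The triple `(X, Xᘁ, Xᘁᘁ)` in a right rigid category. -/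
abbrev of [RightRigidCategory C] (X : C) : RightDualTriple C where
  obj := X
  dual := Xᘁ
  ddual := (Xᘁ)ᘁ
  pair := HasRightDual.exact
  pair' := HasRightDual.exact

end RightDualTriple

open RightDualTriple in
variable (C) in
/-- The double right dual functor `X ↦ Xᘁᘁ`. -/
@[simps]
def rightDoubleDual [RightRigidCategory C] : C ⥤ C where
  obj X := (Xᘁ)ᘁ
  map f := (fᘁ)ᘁ
  map_id X := mate_id (of X)
  map_comp f g := mate_comp (of _) (of _) (of _) f g

open RightDualTriple in
/-- The monoidal structure of the double right dual functor: all its constraints are the double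
transposes of identities. -/
@[simps! -isSimp]
instance rightDoubleDualMonoidal [RightRigidCategory C] : (rightDoubleDual C).Monoidal :=
  Functor.CoreMonoidal.toMonoidal
    { εIso := mateIso (unit C) (of (𝟙_ C)) (Iso.refl _)
      μIso X Y := mateIso ((of X).tensor (of Y)) (of (X ⊗ Y)) (Iso.refl _)
      μIso_hom_natural_left {X Y} f Z :=
        mate_natural_left (of X) (of Y) (of Z) (of (X ⊗ Z)) (of (Y ⊗ Z)) f (𝟙 _) (𝟙 _) (f ▷ Z)
          ((Category.comp_id _).trans (Category.id_comp _).symm)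
      μIso_hom_natural_right {X Y} Z f :=
        mate_natural_right (of X) (of Y) (of Z) (of (Z ⊗ X)) (of (Z ⊗ Y)) f (𝟙 _) (𝟙 _) (Z ◁ f)
          ((Category.comp_id _).trans (Category.id_comp _).symm)
      associativity X Y Z :=
        mate_associativity (of X) (of Y) (of Z) (of (X ⊗ Y)) (of (Y ⊗ Z)) (of ((X ⊗ Y) ⊗ Z))
          (of (X ⊗ Y ⊗ Z)) (𝟙 (X ⊗ Y)) (𝟙 ((X ⊗ Y) ⊗ Z)) (α_ X Y Z).hom (𝟙 (Y ⊗ Z))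
          (𝟙 (X ⊗ Y ⊗ Z)) (by simp [of])
      left_unitality X :=
        mate_left_unitality (of X) (of (𝟙_ C)) (of (𝟙_ C ⊗ X)) (𝟙 (𝟙_ C)) (𝟙 (𝟙_ C ⊗ X))
          (λ_ X).hom (by simp [of])
      right_unitality X :=
        mate_right_unitality (of X) (of (𝟙_ C)) (of (X ⊗ 𝟙_ C)) (𝟙 (𝟙_ C)) (𝟙 (X ⊗ 𝟙_ C))
          (ρ_ X).hom (by simp [of]) }

variable (C) in
/-- An object with a chosen left dual and a chosen left dual of that. -/
structure LeftDualTriple where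
  obj : C
  dual : C
  ddual : C
  pair : ExactPairing dual obj
  pair' : ExactPairing ddual dual

namespace LeftDualTriple

/-- The double transpose of a morphism. -/
def mate (P Q : LeftDualTriple C) (f : P.obj ⟶ Q.obj) : P.ddual ⟶ Q.ddual :=
  leftMate Q.pair' P.pair' (leftMate P.pair Q.pair f)

lemma mate_id (P : LeftDualTriple C) : mate P P (𝟙 P.obj) = 𝟙 P.ddual := by
  simp [mate, leftMate_id]

lemma mate_comp (P Q R : LeftDualTriple C) (f : P.obj ⟶ Q.obj) (g : Q.obj ⟶ R.obj) :
    mate P R (f ≫ g) = mate P Q f ≫ mate Q R g := by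
  simp only [mate]
  rw [leftMate_comp P.pair Q.pair R.pair, leftMate_comp R.pair' Q.pair' P.pair']

/-- The double transpose of an isomorphism. -/
@[simps]
def mateIso (P Q : LeftDualTriple C) (f : P.obj ≅ Q.obj) : P.ddual ≅ Q.ddual where
  hom := mate P Q f.hom
  inv := mate Q P f.inv
  hom_inv_id := by rw [← mate_comp, f.hom_inv_id, mate_id]
  inv_hom_id := by rw [← mate_comp, f.inv_hom_id, mate_id]

/-- The tensor product, with `ᘁ(X ⊗ Y)` chosen to be `ᘁY ⊗ ᘁX`. -/
abbrev tensor (P Q : LeftDualTriple C) : LeftDualTriple C where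
  obj := P.obj ⊗ Q.obj
  dual := Q.dual ⊗ P.dual
  ddual := P.ddual ⊗ Q.ddual
  pair := letI := P.pair; letI := Q.pair; ExactPairing.tensor
  pair' := letI := P.pair'; letI := Q.pair'; ExactPairing.tensor

variable (C) in
/-- The unit, chosen to be its own dual. -/
abbrev unit : LeftDualTriple C where
  obj := 𝟙_ C
  dual := 𝟙_ C
  ddual := 𝟙_ C
  pair := exactPairingUnit
  pair' := exactPairingUnit

lemma mate_tensor (P Q R S : LeftDualTriple C) (f : P.obj ⟶ R.obj) (g : Q.obj ⟶ S.obj) :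
    mate (P.tensor Q) (R.tensor S) (f ⊗ₘ g) = mate P R f ⊗ₘ mate Q S g := by
  have h := leftMate_tensor P.pair Q.pair R.pair S.pair f g
  have h' := leftMate_tensor S.pair' R.pair' Q.pair' P.pair' (leftMate Q.pair S.pair g)
    (leftMate P.pair R.pair f)
  exact (congrArg _ h).trans h'

lemma mate_associator (P Q R : LeftDualTriple C) :
    mate ((P.tensor Q).tensor R) (P.tensor (Q.tensor R)) (α_ P.obj Q.obj R.obj).hom =
      (α_ P.ddual Q.ddual R.ddual).hom := by
  have h := leftMate_associator P.pair Q.pair R.pair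
  have h' := leftMate_associator R.pair' Q.pair' P.pair'
  exact (congrArg _ h).trans h'

lemma mate_leftUnitor (P : LeftDualTriple C) :
    mate ((unit C).tensor P) P (λ_ P.obj).hom = (λ_ P.ddual).hom := by
  let _ := P.pair'
  have h := leftMate_leftUnitor P.pair
  have h' := leftMate_rightUnitor P.pair'
  have e : leftMate P.pair' (ExactPairing.tensor (Y₂ := P.dual) (Y₁ := 𝟙_ C) (X₁ := 𝟙_ C))
      (ρ_ P.dual).inv = (λ_ P.ddual).hom := by
    rw [← cancel_epi (λ_ P.ddual).inv, Iso.inv_hom_id, ← h', ← leftMate_comp, Iso.inv_hom_id,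
      leftMate_id]
  exact (congrArg _ h).trans e

lemma mate_rightUnitor (P : LeftDualTriple C) :
    mate (P.tensor (unit C)) P (ρ_ P.obj).hom = (ρ_ P.ddual).hom := by
  let _ := P.pair'
  have h := leftMate_rightUnitor P.pair
  have h' := leftMate_leftUnitor P.pair'
  have e : leftMate P.pair' (ExactPairing.tensor (Y₂ := 𝟙_ C) (Y₁ := P.dual) (X₂ := 𝟙_ C))
      (λ_ P.dual).inv = (ρ_ P.ddual).hom := by
    rw [← cancel_epi (ρ_ P.ddual).inv, Iso.inv_hom_id, ← h', ← leftMate_comp, Iso.inv_hom_id,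
      leftMate_id]
  exact (congrArg _ h).trans e

lemma mate_whiskerRight (P Q R : LeftDualTriple C) (f : P.obj ⟶ Q.obj) :
    mate (P.tensor R) (Q.tensor R) (f ▷ R.obj) = mate P Q f ▷ R.ddual := by
  have h := mate_tensor P R Q R f (𝟙 R.obj)
  rwa [mate_id, tensorHom_id, tensorHom_id] at h

lemma mate_whiskerLeft (P Q R : LeftDualTriple C) (f : P.obj ⟶ Q.obj) :
    mate (R.tensor P) (R.tensor Q) (R.obj ◁ f) = R.ddual ◁ mate P Q f := by
  have h := mate_tensor R P R Q (𝟙 R.obj) f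
  rwa [mate_id, id_tensorHom, id_tensorHom] at h

lemma mate_natural_left (P Q R U V : LeftDualTriple C) (f : P.obj ⟶ Q.obj)
    (e : P.obj ⊗ R.obj ⟶ U.obj) (e' : Q.obj ⊗ R.obj ⟶ V.obj) (g : U.obj ⟶ V.obj)
    (h : f ▷ R.obj ≫ e' = e ≫ g) :
    mate P Q f ▷ R.ddual ≫ mate (Q.tensor R) V e' = mate (P.tensor R) U e ≫ mate U V g := by
  rw [← mate_whiskerRight, ← mate_comp, ← mate_comp]
  exact congrArg _ h

lemma mate_natural_right (P Q R U V : LeftDualTriple C) (f : P.obj ⟶ Q.obj)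
    (e : R.obj ⊗ P.obj ⟶ U.obj) (e' : R.obj ⊗ Q.obj ⟶ V.obj) (g : U.obj ⟶ V.obj)
    (h : R.obj ◁ f ≫ e' = e ≫ g) :
    R.ddual ◁ mate P Q f ≫ mate (R.tensor Q) V e' = mate (R.tensor P) U e ≫ mate U V g := by
  rw [← mate_whiskerLeft, ← mate_comp, ← mate_comp]
  exact congrArg _ h

lemma mate_associativity (P Q R U V W W' : LeftDualTriple C) (e : P.obj ⊗ Q.obj ⟶ U.obj)
    (g : U.obj ⊗ R.obj ⟶ W.obj) (h : W.obj ⟶ W'.obj) (e' : Q.obj ⊗ R.obj ⟶ V.obj)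
    (g' : P.obj ⊗ V.obj ⟶ W'.obj)
    (H : e ▷ R.obj ≫ g ≫ h = (α_ _ _ _).hom ≫ P.obj ◁ e' ≫ g') :
    mate (P.tensor Q) U e ▷ R.ddual ≫ mate (U.tensor R) W g ≫ mate W W' h =
      (α_ _ _ _).hom ≫ P.ddual ◁ mate (Q.tensor R) V e' ≫ mate (P.tensor V) W' g' := by
  rw [← mate_whiskerRight, ← mate_whiskerLeft, ← mate_associator, ← mate_comp, ← mate_comp,
    ← mate_comp, ← mate_comp, H]

lemma mate_left_unitality (P U V : LeftDualTriple C) (e : 𝟙_ C ⟶ U.obj)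
    (g : U.obj ⊗ P.obj ⟶ V.obj) (h : V.obj ⟶ P.obj) (H : (λ_ P.obj).hom = e ▷ P.obj ≫ g ≫ h) :
    (λ_ P.ddual).hom = mate (unit C) U e ▷ P.ddual ≫ mate (U.tensor P) V g ≫ mate V P h := by
  rw [← mate_whiskerRight, ← mate_leftUnitor, ← mate_comp, ← mate_comp, H]

lemma mate_right_unitality (P U V : LeftDualTriple C) (e : 𝟙_ C ⟶ U.obj)
    (g : P.obj ⊗ U.obj ⟶ V.obj) (h : V.obj ⟶ P.obj) (H : (ρ_ P.obj).hom = P.obj ◁ e ≫ g ≫ h) :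
    (ρ_ P.ddual).hom = P.ddual ◁ mate (unit C) U e ≫ mate (P.tensor U) V g ≫ mate V P h := by
  rw [← mate_whiskerLeft, ← mate_rightUnitor, ← mate_comp, ← mate_comp, H]

/-- The triple `(X, ᘁX, ᘁᘁX)` in a left rigid category. -/
abbrev of [LeftRigidCategory C] (X : C) : LeftDualTriple C where
  obj := X
  dual := HasLeftDual.leftDual X
  ddual := HasLeftDual.leftDual (HasLeftDual.leftDual X)
  pair := HasLeftDual.exact
  pair' := HasLeftDual.exact

end LeftDualTriple

open LeftDualTriple in
variable (C) in
/-- The double left dual functor `X ↦ ᘁᘁX`. -/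
@[simps]
def leftDoubleDual [LeftRigidCategory C] : C ⥤ C where
  obj X := HasLeftDual.leftDual (HasLeftDual.leftDual X)
  map f := leftAdjointMate (leftAdjointMate f)
  map_id X := mate_id (of X)
  map_comp f g := mate_comp (of _) (of _) (of _) f g

open LeftDualTriple in
/-- The monoidal structure of the double left dual functor: all its constraints are the double
transposes of identities. -/
@[simps! -isSimp]
instance leftDoubleDualMonoidal [LeftRigidCategory C] : (leftDoubleDual C).Monoidal :=
  Functor.CoreMonoidal.toMonoidal
    { εIso := mateIso (unit C) (of (𝟙_ C)) (Iso.refl _)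
      μIso X Y := mateIso ((of X).tensor (of Y)) (of (X ⊗ Y)) (Iso.refl _)
      μIso_hom_natural_left {X Y} f Z :=
        mate_natural_left (of X) (of Y) (of Z) (of (X ⊗ Z)) (of (Y ⊗ Z)) f (𝟙 _) (𝟙 _) (f ▷ Z)
          ((Category.comp_id _).trans (Category.id_comp _).symm)
      μIso_hom_natural_right {X Y} Z f :=
        mate_natural_right (of X) (of Y) (of Z) (of (Z ⊗ X)) (of (Z ⊗ Y)) f (𝟙 _) (𝟙 _) (Z ◁ f)
          ((Category.comp_id _).trans (Category.id_comp _).symm)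
      associativity X Y Z :=
        mate_associativity (of X) (of Y) (of Z) (of (X ⊗ Y)) (of (Y ⊗ Z)) (of ((X ⊗ Y) ⊗ Z))
          (of (X ⊗ Y ⊗ Z)) (𝟙 (X ⊗ Y)) (𝟙 ((X ⊗ Y) ⊗ Z)) (α_ X Y Z).hom (𝟙 (Y ⊗ Z))
          (𝟙 (X ⊗ Y ⊗ Z)) (by simp [of])
      left_unitality X :=
        mate_left_unitality (of X) (of (𝟙_ C)) (of (𝟙_ C ⊗ X)) (𝟙 (𝟙_ C)) (𝟙 (𝟙_ C ⊗ X))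
          (λ_ X).hom (by simp [of])
      right_unitality X :=
        mate_right_unitality (of X) (of (𝟙_ C)) (of (X ⊗ 𝟙_ C)) (𝟙 (𝟙_ C)) (𝟙 (X ⊗ 𝟙_ C))
          (ρ_ X).hom (by simp [of]) }

end DoubleDual

section Restriction

variable {C C' D : Type*} [Category* C] [MonoidalCategory C] [Category* C']
  [MonoidalCategory C'] [Category* D]

open MonoidalLeftAction Functor.LaxMonoidal Functor.OplaxMonoidal in
/-- Restriction of a left action along a monoidal functor. -/
@[reducible]
def restrictLeftAction [MonoidalLeftAction C' D] (F : C ⥤ C') [F.Monoidal] :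
    MonoidalLeftAction C D where
  actionObj c d := F.obj c ⊙ₗ d
  actionHomLeft f d := F.map f ⊵ₗ d
  actionHomRight c _ _ f := F.obj c ⊴ₗ f
  actionHom f g := F.map f ⊙ₗₘ g
  actionAssocIso c c' d :=
    { hom := δ F c c' ⊵ₗ d ≫ (αₗ (F.obj c) (F.obj c') d).hom
      inv := (αₗ (F.obj c) (F.obj c') d).inv ≫ μ F c c' ⊵ₗ d
      hom_inv_id := by
        simp [← comp_actionHomLeft]
      inv_hom_id := by
        rw [Category.assoc, ← comp_actionHomLeft_assoc]; simp }
  actionUnitIso d :=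
    { hom := η F ⊵ₗ d ≫ (λₗ d).hom
      inv := (λₗ d).inv ≫ ε F ⊵ₗ d
      hom_inv_id := by simp [← comp_actionHomLeft]
      inv_hom_id := by rw [Category.assoc, ← comp_actionHomLeft_assoc]; simp }
  actionHom_def f g := actionHom_def (F.map f) g
  actionHomRight_id c d := actionHomRight_id (F.obj c) d
  id_actionHomLeft c d := by rw [F.map_id, id_actionHomLeft]
  actionHom_comp f₁ f₂ g₁ g₂ := by rw [F.map_comp, actionHom_comp]
  actionAssocIso_hom_naturality f g h := by
    dsimp only
    rw [Category.assoc, ← actionAssocIso_hom_naturality, ← actionHom_id, ← actionHom_id,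
      ← actionHom_comp_assoc, ← actionHom_comp_assoc]
    simp
  actionUnitIso_hom_naturality f := by
    dsimp only
    rw [Category.assoc, actionUnitIso_hom_naturality, action_exchange_assoc]
  whiskerLeft_actionHomLeft c _ _ f d := by
    have h : F.map (c ◁ f) = δ F _ _ ≫ F.obj c ◁ F.map f ≫ μ F _ _ := by simp
    simp only [h, comp_actionHomLeft, actionHomRight_comp, whiskerLeft_actionHomLeft, whiskerRight_actionHomLeft,
      Category.assoc, Iso.inv_hom_id_assoc]
  whiskerRight_actionHomLeft c'' f d := by
    have h : F.map (f ▷ c'') = δ F _ _ ≫ F.map f ▷ F.obj c'' ≫ μ F _ _ := by simp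
    simp only [h, comp_actionHomLeft, actionHomRight_comp, whiskerLeft_actionHomLeft, whiskerRight_actionHomLeft,
      Category.assoc, Iso.inv_hom_id_assoc]
  associator_actionHom c₁ c₂ c₃ d := by
    have h := congrArg (fun t => t ⊵ₗ d) (Functor.OplaxMonoidal.associativity F c₁ c₂ c₃)
    have h' := h =≫ ((αₗ _ _ _).hom ≫ F.obj c₁ ⊴ₗ (αₗ _ _ _).hom)
    simp only [comp_actionHomLeft, actionHomRight_comp, whiskerLeft_actionHomLeft, whiskerRight_actionHomLeft,
      Category.assoc, Iso.inv_hom_id_assoc,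
      associator_actionHom] at h'
    simp only [comp_actionHomLeft, actionHomRight_comp, whiskerLeft_actionHomLeft, whiskerRight_actionHomLeft,
      Category.assoc, Iso.inv_hom_id_assoc]
    exact h'.symm
  leftUnitor_actionHom c d := by
    rw [← Functor.OplaxMonoidal.left_unitality_hom]
    simp only [comp_actionHomLeft, actionHomRight_comp, whiskerLeft_actionHomLeft, whiskerRight_actionHomLeft,
      Category.assoc, Iso.inv_hom_id_assoc,
      leftUnitor_actionHom]
  rightUnitor_actionHom c d := by
    rw [← Functor.OplaxMonoidal.right_unitality_hom]
    simp only [comp_actionHomLeft, actionHomRight_comp, whiskerLeft_actionHomLeft, whiskerRight_actionHomLeft,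
      Category.assoc, Iso.inv_hom_id_assoc,
      rightUnitor_actionHom]

open MonoidalRightAction Functor.LaxMonoidal Functor.OplaxMonoidal in
/-- Restriction of a right action along a monoidal functor. -/
@[reducible]
def restrictRightAction [MonoidalRightAction C' D] (F : C ⥤ C') [F.Monoidal] :
    MonoidalRightAction C D where
  actionObj d c := d ⊙ᵣ F.obj c
  actionHomLeft f c := f ⊵ᵣ F.obj c
  actionHomRight d _ _ f := d ⊴ᵣ F.map f
  actionHom f g := f ⊙ᵣₘ F.map g
  actionAssocIso d c c' :=
    { hom := d ⊴ᵣ δ F c c' ≫ (αᵣ d (F.obj c) (F.obj c')).hom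
      inv := (αᵣ d (F.obj c) (F.obj c')).inv ≫ d ⊴ᵣ μ F c c'
      hom_inv_id := by simp [← actionHomRight_comp]
      inv_hom_id := by rw [Category.assoc, ← actionHomRight_comp_assoc]; simp }
  actionUnitIso d :=
    { hom := d ⊴ᵣ η F ≫ (ρᵣ d).hom
      inv := (ρᵣ d).inv ≫ d ⊴ᵣ ε F
      hom_inv_id := by simp [← actionHomRight_comp]
      inv_hom_id := by rw [Category.assoc, ← actionHomRight_comp_assoc]; simp }
  actionHom_def f g := actionHom_def f (F.map g)
  actionHomRight_id c d := by rw [F.map_id, actionHomRight_id]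
  id_actionHomLeft c d := id_actionHomLeft (F.obj c) d
  actionHom_comp f₁ f₂ g₁ g₂ := by rw [F.map_comp, actionHom_comp]
  actionAssocIso_hom_naturality f g h := by
    dsimp only
    rw [Category.assoc, ← actionAssocIso_hom_naturality, ← id_actionHom, ← id_actionHom,
      ← actionHom_comp_assoc, ← actionHom_comp_assoc]
    simp
  actionUnitIso_hom_naturality f := by
    dsimp only
    rw [Category.assoc, actionUnitIso_hom_naturality, action_exchange_assoc]
  actionHomRight_whiskerRight f c d := by
    have h : F.map (f ▷ c) = δ F _ _ ≫ F.map f ▷ F.obj c ≫ μ F _ _ := by simp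
    simp only [h, actionHomRight_comp, comp_actionHomLeft, actionHomRight_whiskerRight, whiskerRight_actionHomLeft,
      Category.assoc, Iso.inv_hom_id_assoc]
  whiskerRight_actionHomLeft c _ _ f d := by
    have h : F.map (c ◁ f) = δ F _ _ ≫ F.obj c ◁ F.map f ≫ μ F _ _ := by simp
    simp only [h, actionHomRight_comp, comp_actionHomLeft, actionHomRight_whiskerRight, whiskerRight_actionHomLeft,
      Category.assoc, Iso.inv_hom_id_assoc]
  actionHom_associator c₁ c₂ c₃ d := by
    have h := congrArg (fun t => d ⊴ᵣ t) (Functor.OplaxMonoidal.associativity F c₁ c₂ c₃)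
    have h' := h =≫ ((αᵣ _ _ _).hom ≫ (αᵣ _ _ _).hom)
    simp only [actionHomRight_comp, comp_actionHomLeft, actionHomRight_whiskerRight, whiskerRight_actionHomLeft,
      Category.assoc, Iso.inv_hom_id_assoc,
      actionHom_associator] at h'
    simp only [actionHomRight_comp, comp_actionHomLeft, actionHomRight_whiskerRight, whiskerRight_actionHomLeft,
      Category.assoc, Iso.inv_hom_id_assoc]
    exact h'.symm
  actionHom_leftUnitor c d := by
    rw [← Functor.OplaxMonoidal.left_unitality_hom]
    simp only [actionHomRight_comp, comp_actionHomLeft, actionHomRight_whiskerRight, whiskerRight_actionHomLeft,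
      Category.assoc, Iso.inv_hom_id_assoc,
      actionHom_leftUnitor]
  actionHom_rightUnitor c d := by
    rw [← Functor.OplaxMonoidal.right_unitality_hom]
    simp only [actionHomRight_comp, comp_actionHomLeft, actionHomRight_whiskerRight, whiskerRight_actionHomLeft,
      Category.assoc, Iso.inv_hom_id_assoc,
      actionHom_rightUnitor]

end Restriction


section FiniteLinear

universe w v u

/-- A `k`-linear category is finite if it is equivalent, as a linear category, to the category of
finite-dimensional modules over a finite-dimensional `k`-algebra. -/
class IsFiniteLinear (k : Type w) [Field k] (C : Type u) [Category.{v} C] [Preadditive C]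
    [Linear k C] : Prop where
  exists_equivalence : ∃ (R : Type v) (_ : Ring R) (_ : Algebra k R) (_ : Module.Finite k R)
    (E : C ≌ FGModuleCat.{v} R), E.functor.Additive ∧ E.functor.Linear k

open scoped ModuleCat in
instance IsFiniteLinear.finite_hom (k : Type w) [Field k] {C : Type u} [Category.{v} C]
    [Preadditive C] [Linear k C] [IsFiniteLinear k C] (X Y : C) : Module.Finite k (X ⟶ Y) := by
  obtain ⟨R, _, _, _, E, _, _⟩ := IsFiniteLinear.exists_equivalence (k := k) (C := C)
  have : Module.Finite k ((E.functor.obj X).obj ⟶ (E.functor.obj Y).obj) := by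
    have hX : Module.Finite k (E.functor.obj X).obj := Module.Finite.trans R _
    have hY : Module.Finite k (E.functor.obj Y).obj := Module.Finite.trans R _
    let φ : ((E.functor.obj X).obj ⟶ (E.functor.obj Y).obj) →ₗ[k]
        ((E.functor.obj X).obj →ₗ[k] (E.functor.obj Y).obj) :=
      { toFun f := f.hom.restrictScalars k
        map_add' _ _ := rfl
        map_smul' _ _ := rfl }
    refine Module.Finite.of_injective φ fun f g h => ?_
    ext x
    exact LinearMap.congr_fun h x
  let ψ : (X ⟶ Y) →ₗ[k] ((E.functor.obj X).obj ⟶ (E.functor.obj Y).obj) :=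
    { toFun f := (E.functor.map f).hom
      map_add' f g := by rw [E.functor.map_add]; rfl
      map_smul' r f := by rw [E.functor.map_smul]; rfl }
  refine Module.Finite.of_injective ψ fun f g h => E.functor.map_injective ?_
  exact ObjectProperty.hom_ext _ h

attribute [instance] Abelian.hasFiniteBiproducts

end FiniteLinear

section Copower

variable (k : Type*) [Field k] {C : Type*} [Category* C] [Preadditive C] [Linear k C]
  [HasFiniteBiproducts C]

/-- The object `V ⊗ y` for a finite-dimensional vector space `V`: the direct sum of copies of `y`
indexed by a basis of `V`. -/
noncomputable abbrev copower (V : Type*) [AddCommGroup V] [Module k V] (y : C) : C :=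
  ⨁ fun _ : Fin (Module.finrank k V) => y

namespace copower

variable {k} {V W : Type*} [AddCommGroup V] [Module k V] [Module.Finite k V]
  [AddCommGroup W] [Module k W] [Module.Finite k W]

variable (k) in
/-- The universal linear map `V → Hom(y, V ⊗ y)`. -/
noncomputable def ι (V : Type*) [AddCommGroup V] [Module k V] [Module.Finite k V] (y : C) :
    V →ₗ[k] (y ⟶ copower k V y) where
  toFun v := biproduct.lift fun i => (Module.finBasis k V).repr v i • 𝟙 y
  map_add' v w := by
    ext i
    simp [add_smul]
  map_smul' r v := by
    ext i
    simp [mul_smul]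

lemma ι_apply (y : C) (v : V) :
    ι k V y v = biproduct.lift fun i => (Module.finBasis k V).repr v i • 𝟙 y :=
  rfl

/-- The morphism `V ⊗ y ⟶ z` induced by a linear map `V → Hom(y, z)`. -/
noncomputable def desc {y z : C} (φ : V →ₗ[k] (y ⟶ z)) : copower k V y ⟶ z :=
  biproduct.desc fun i => φ (Module.finBasis k V i)

lemma ι_desc {y z : C} (φ : V →ₗ[k] (y ⟶ z)) (v : V) : ι k V y v ≫ desc φ = φ v := by
  simp only [ι_apply, desc, biproduct.lift_desc, Linear.smul_comp,
    Category.id_comp]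
  conv_rhs => rw [← (Module.finBasis k V).sum_repr v, map_sum]
  simp only [map_smul]

lemma hom_ext {y z : C} {f g : copower k V y ⟶ z}
    (h : ∀ v, ι k V y v ≫ f = ι k V y v ≫ g) : f = g := by
  have key (i) : ι k V y (Module.finBasis k V i) =
      biproduct.ι (fun _ : Fin (Module.finrank k V) => y) i := by
    ext j
    by_cases hij : i = j
    · subst hij; simp [ι_apply]
    · simp [biproduct.ι_π_ne _ hij, Finsupp.single_apply, hij, ι_apply]
  ext i
  rw [← key]
  exact h _

/-- The functoriality of `V ⊗ y` in both variables. -/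
noncomputable def map (φ : V →ₗ[k] W) {y z : C} (g : y ⟶ z) : copower k V y ⟶ copower k W z :=
  desc ((Linear.leftComp k (copower k W z) g).comp ((ι k W z).comp φ))

lemma ι_map (φ : V →ₗ[k] W) {y z : C} (g : y ⟶ z) (v : V) :
    ι k V y v ≫ map φ g = g ≫ ι k W z (φ v) := by
  simp [map, ι_desc]

lemma map_id (y : C) : map (LinearMap.id : V →ₗ[k] V) (𝟙 y) = 𝟙 (copower k V y) :=
  hom_ext fun v => by simp [ι_map]

lemma map_comp {U : Type*} [AddCommGroup U] [Module k U] [Module.Finite k U] (φ : V →ₗ[k] W)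
    (ψ : W →ₗ[k] U) {x y z : C} (f : x ⟶ y) (g : y ⟶ z) :
    map φ f ≫ map ψ g = map (ψ.comp φ) (f ≫ g) :=
  hom_ext fun v => by rw [reassoc_of% ι_map, ι_map, ι_map, Category.assoc, LinearMap.comp_apply]

/-- The canonical morphism `V ⊗ F(y) ⟶ F(V ⊗ y)` for a linear functor `F`. -/
noncomputable def comparison {D : Type*} [Category* D] [Preadditive D] [Linear k D]
    [HasFiniteBiproducts D] (F : C ⥤ D) [F.Additive] [F.Linear k] (V : Type*) [AddCommGroup V]
    [Module k V] [Module.Finite k V] (y : C) : copower k V (F.obj y) ⟶ F.obj (copower k V y) :=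
  desc ((F.mapLinearMap k).comp (ι k V y))

end copower

end Copower


section Nakayama

universe w v u

variable (k : Type w) [Field k] {M : Type u} [Category.{v} M] [Preadditive M] [Linear k M]
  [HasFiniteBiproducts M] [IsFiniteLinear k M]

/-- The bifunctor `(x, y) ↦ Hom(x, m) ⊗ y`. -/
noncomputable def nakayamaIntegrand (m : M) : Mᵒᵖ ⥤ M ⥤ M where
  obj x :=
    { obj y := copower k (x.unop ⟶ m) y
      map g := copower.map LinearMap.id g
      map_id y := copower.map_id y
      map_comp f g := by rw [copower.map_comp, LinearMap.id_comp] }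
  map f :=
    { app y := copower.map (Linear.leftComp k m f.unop) (𝟙 y)
      naturality y z g := by simp [copower.map_comp] }
  map_id x := by
    refine NatTrans.ext (funext fun y => ?_)
    have h : Linear.leftComp k m (𝟙 x.unop) = LinearMap.id :=
      LinearMap.ext fun t => Category.id_comp t
    exact (congrArg (fun φ => copower.map φ (𝟙 y)) h).trans (copower.map_id y)
  map_comp {x₁ x₂ x₃} f g := by
    refine NatTrans.ext (funext fun y => ?_)
    have h : Linear.leftComp k m (g.unop ≫ f.unop) =
        (Linear.leftComp k m g.unop).comp (Linear.leftComp k m f.unop) :=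
      LinearMap.ext fun t => Category.assoc _ _ t
    change copower.map (Linear.leftComp k m (g.unop ≫ f.unop)) (𝟙 y) =
      copower.map _ (𝟙 y) ≫ copower.map _ (𝟙 y)
    rw [copower.map_comp, Category.id_comp, h]

variable (M) in
/-- A choice, for every object `m`, of an end `∫_x Hom(x, m) ⊗ x`: an object together with a
universal dinatural family of morphisms to the objects `Hom(x, m) ⊗ x`. -/
structure NakayamaEnds where
  wedge (m : M) : Wedge (nakayamaIntegrand k m)
  isLimit (m : M) : IsLimit (wedge m)

namespace NakayamaEnds

variable {k}

/-- The structure morphism `∫_x Hom(x, m) ⊗ x ⟶ Hom(x, m) ⊗ x` of the end. -/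
noncomputable def proj (E : NakayamaEnds k M) (m x : M) :
    (E.wedge m).pt ⟶ copower k (x ⟶ m) x :=
  (E.wedge m).ι x

lemma proj_dinatural (E : NakayamaEnds k M) (m : M) {x y : M} (f : x ⟶ y) :
    E.proj m x ≫ copower.map LinearMap.id f =
      E.proj m y ≫ copower.map (Linear.leftComp k m f) (𝟙 y) :=
  (E.wedge m).condition f

lemma hom_ext (E : NakayamaEnds k M) {m z : M} {f g : z ⟶ (E.wedge m).pt}
    (h : ∀ x, f ≫ E.proj m x = g ≫ E.proj m x) : f = g :=
  Wedge.IsLimit.hom_ext (E.isLimit m) h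

/-- The action of the end on morphisms. -/
noncomputable def map (E : NakayamaEnds k M) {m m' : M} (f : m ⟶ m') :
    (E.wedge m).pt ⟶ (E.wedge m').pt :=
  Wedge.IsLimit.lift (E.isLimit m')
    (fun x => E.proj m x ≫ copower.map (Linear.rightComp k x f) (𝟙 x))
    (fun x y g => by
      have h : (Linear.leftComp k m' g).comp (Linear.rightComp k y f) =
          (Linear.rightComp k x f).comp (Linear.leftComp k m g) :=
        LinearMap.ext fun t => (Category.assoc g t f).symm
      dsimp [nakayamaIntegrand]
      rw [Category.assoc, Category.assoc, copower.map_comp, copower.map_comp, h,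
        ← copower.map_comp _ _ (𝟙 y) (𝟙 y), ← reassoc_of% proj_dinatural, copower.map_comp]
      simp)

lemma map_proj (E : NakayamaEnds k M) {m m' : M} (f : m ⟶ m') (x : M) :
    E.map f ≫ E.proj m' x = E.proj m x ≫ copower.map (Linear.rightComp k x f) (𝟙 x) :=
  Wedge.IsLimit.lift_ι (E.isLimit m') _ _ x

/-- The left exact Nakayama functor `m ↦ ∫_x Hom(x, m) ⊗ x`. -/
noncomputable def functor (E : NakayamaEnds k M) : M ⥤ M where
  obj m := (E.wedge m).pt
  map f := E.map f
  map_id m := E.hom_ext fun x => by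
    have h : Linear.rightComp k x (𝟙 m) = LinearMap.id :=
      LinearMap.ext fun t => Category.comp_id t
    rw [map_proj, h, copower.map_id, Category.comp_id, Category.id_comp]
  map_comp f g := E.hom_ext fun x => by
    have h : Linear.rightComp k x (f ≫ g) =
        (Linear.rightComp k x g).comp (Linear.rightComp k x f) :=
      LinearMap.ext fun t => (Category.assoc t f g).symm
    rw [map_proj, Category.assoc, map_proj, reassoc_of% map_proj, copower.map_comp, h, Category.comp_id]

end NakayamaEnds

end Nakayama


section Bimodule

open MonoidalLeftAction MonoidalRightAction

/-- The structure of an `A`-`B`-bimodule category on a category `M` with a left action of `A` and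
a right action of `B`: middle associativity constraints `(a.m).b ≅ a.(m.b)`, natural in all
variables and satisfying the two pentagon relations. -/
class BimoduleCategory (A B M : Type*) [Category* A] [MonoidalCategory A] [Category* B]
    [MonoidalCategory B] [Category* M] [MonoidalLeftAction A M] [MonoidalRightAction B M] where
  mid (a : A) (m : M) (b : B) : (a ⊙ₗ m) ⊙ᵣ b ≅ a ⊙ₗ (m ⊙ᵣ b)
  mid_naturality {a a' : A} {m m' : M} {b b' : B} (f : a ⟶ a') (g : m ⟶ m') (h : b ⟶ b') :
    ((f ⊙ₗₘ g) ⊙ᵣₘ h) ≫ (mid a' m' b').hom = (mid a m b).hom ≫ (f ⊙ₗₘ (g ⊙ᵣₘ h))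
  mid_left (a a' : A) (m : M) (b : B) :
    (αₗ a a' m).hom ⊵ᵣ b ≫ (mid a (a' ⊙ₗ m) b).hom ≫ a ⊴ₗ (mid a' m b).hom =
      (mid (a ⊗ a') m b).hom ≫ (αₗ a a' (m ⊙ᵣ b)).hom
  mid_right (a : A) (m : M) (b b' : B) :
    (αᵣ (a ⊙ₗ m) b b').hom ≫ (mid a m b).hom ⊵ᵣ b' ≫ (mid a (m ⊙ᵣ b) b').hom =
      (mid a m (b ⊗ b')).hom ≫ a ⊴ₗ (αᵣ m b b').hom

/-- Restriction of a bimodule category along two monoidal functors. -/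
@[reducible]
def restrictBimodule {A A' B B' M : Type*} [Category* A] [MonoidalCategory A] [Category* A']
    [MonoidalCategory A'] [Category* B] [MonoidalCategory B] [Category* B'] [MonoidalCategory B']
    [Category* M] [MonoidalLeftAction A' M] [MonoidalRightAction B' M] [BimoduleCategory A' B' M]
    (F : A ⥤ A') [F.Monoidal] (G : B ⥤ B') [G.Monoidal] :
    letI : MonoidalLeftAction A M := restrictLeftAction F
    letI : MonoidalRightAction B M := restrictRightAction G
    BimoduleCategory A B M :=
  letI : MonoidalLeftAction A M := restrictLeftAction F
  letI : MonoidalRightAction B M := restrictRightAction G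
  { mid a m b := BimoduleCategory.mid (F.obj a) m (G.obj b)
    mid_naturality f g h := BimoduleCategory.mid_naturality (F.map f) g (G.map h)
    mid_left a a' m b := by
      have h := BimoduleCategory.mid_left (F.obj a) (F.obj a') m (G.obj b)
      have n := BimoduleCategory.mid_naturality (Functor.OplaxMonoidal.δ F a a') (𝟙 m)
        (𝟙 (G.obj b))
      simp only [MonoidalLeftAction.actionHom_id, MonoidalRightAction.actionHom_id,
        MonoidalRightAction.id_actionHomLeft] at n
      change (Functor.OplaxMonoidal.δ F a a' ⊵ₗ m ≫ (αₗ (F.obj a) (F.obj a') m).hom) ⊵ᵣ G.obj b ≫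
        (BimoduleCategory.mid (F.obj a) (F.obj a' ⊙ₗ m) (G.obj b)).hom ≫
          F.obj a ⊴ₗ (BimoduleCategory.mid (F.obj a') m (G.obj b)).hom =
        (BimoduleCategory.mid (F.obj (a ⊗ a')) m (G.obj b)).hom ≫
          Functor.OplaxMonoidal.δ F a a' ⊵ₗ (m ⊙ᵣ G.obj b) ≫
            (αₗ (F.obj a) (F.obj a') (m ⊙ᵣ G.obj b)).hom
      rw [MonoidalRightAction.comp_actionHomLeft, Category.assoc, h, reassoc_of% n]
    mid_right a m b b' := by
      have h := BimoduleCategory.mid_right (F.obj a) m (G.obj b) (G.obj b')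
      have n := BimoduleCategory.mid_naturality (𝟙 (F.obj a)) (𝟙 m)
        (Functor.OplaxMonoidal.δ G b b')
      simp only [MonoidalLeftAction.id_actionHom, MonoidalRightAction.id_actionHom,
        MonoidalLeftAction.actionHomRight_id] at n
      change ((F.obj a ⊙ₗ m) ⊴ᵣ Functor.OplaxMonoidal.δ G b b' ≫
          (αᵣ (F.obj a ⊙ₗ m) (G.obj b) (G.obj b')).hom) ≫
        (BimoduleCategory.mid (F.obj a) m (G.obj b)).hom ⊵ᵣ G.obj b' ≫
          (BimoduleCategory.mid (F.obj a) (m ⊙ᵣ G.obj b) (G.obj b')).hom =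
        (BimoduleCategory.mid (F.obj a) m (G.obj (b ⊗ b'))).hom ≫
          F.obj a ⊴ₗ (m ⊴ᵣ Functor.OplaxMonoidal.δ G b b' ≫ (αᵣ m (G.obj b) (G.obj b')).hom)
      rw [MonoidalLeftAction.actionHomRight_comp, Category.assoc, h, reassoc_of% n] }

/-- A bimodule functor between `A`-`B`-bimodule categories: a functor with natural isomorphisms
`F(a.m) ≅ a.F(m)` and `F(m.b) ≅ F(m).b` that make it a left and a right module functor and that are
compatible with the middle associativity constraints. -/
class BimoduleFunctor (A B : Type*) [Category* A] [MonoidalCategory A] [Category* B]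
    [MonoidalCategory B] {M M' : Type*} [Category* M] [MonoidalLeftAction A M]
    [MonoidalRightAction B M] [BimoduleCategory A B M] [Category* M'] [MonoidalLeftAction A M']
    [MonoidalRightAction B M'] [BimoduleCategory A B M'] (F : M ⥤ M') extends
    F.LeftLinear A, F.RightLinear B where
  map_mid (a : A) (m : M) (b : B) :
    F.map (BimoduleCategory.mid a m b).hom ≫ δₗ a (m ⊙ᵣ b) ≫ a ⊴ₗ δᵣ m b =
      δᵣ (a ⊙ₗ m) b ≫ δₗ a m ⊵ᵣ b ≫ (BimoduleCategory.mid a (F.obj m) b).hom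

/-- The underlying category of an `A`-`B`-bimodule category `M`, to be equipped with the actions
twisted by the double right dual of `A` and the double left dual of `B`. -/
def DoubleDualTwist (_A _B M : Type*) := M

section Twist

variable (A B M : Type*) [Category* A] [MonoidalCategory A] [Category* B] [MonoidalCategory B]
  [Category* M]

instance : Category (DoubleDualTwist A B M) := inferInstanceAs (Category M)

/-- The identity functor from `M` to its twist. -/
def toTwist : M ⥤ DoubleDualTwist A B M := 𝟭 M

/-- The left action `a, m ↦ aᘁᘁ.m`. -/
instance [RightRigidCategory A] [MonoidalLeftAction A M] :
    MonoidalLeftAction A (DoubleDualTwist A B M) :=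
  restrictLeftAction (D := M) (rightDoubleDual A)

/-- The right action `m, b ↦ m.ᘁᘁb`. -/
instance [LeftRigidCategory B] [MonoidalRightAction B M] :
    MonoidalRightAction B (DoubleDualTwist A B M) :=
  restrictRightAction (D := M) (leftDoubleDual B)

instance [RightRigidCategory A] [LeftRigidCategory B] [MonoidalLeftAction A M]
    [MonoidalRightAction B M] [BimoduleCategory A B M] :
    BimoduleCategory A B (DoubleDualTwist A B M) :=
  restrictBimodule (M := M) (rightDoubleDual A) (leftDoubleDual B)

end Twist

end Bimodule


section Main

open MonoidalLeftAction MonoidalRightAction HasRightDual HasLeftDual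

/-- A finite tensor category over `k`: a finite `k`-linear abelian rigid monoidal category with
bilinear tensor product and `End(𝟙) = k`. -/
class IsFiniteTensorCategory (k : Type*) [Field k] (A : Type*) [Category* A] [Abelian A]
    [Linear k A] [MonoidalCategory A] [MonoidalPreadditive A] [MonoidalLinear k A]
    [RigidCategory A] : Prop extends IsFiniteLinear k A where
  finrank_end_unit : Module.finrank k (𝟙_ A ⟶ 𝟙_ A) = 1

/-- The action functor `A × M ⥤ M` of a left module category is `k`-bilinear, and it is exact in
the first variable. -/
class IsLinearLeftModule (k A M : Type*) [Field k] [Category* A] [Preadditive A] [Linear k A]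
    [MonoidalCategory A] [Category* M] [Preadditive M] [Linear k M] [MonoidalLeftAction A M] :
    Prop where
  additive_left (a : A) : (MonoidalLeftAction.actionLeft M a).Additive
  linear_left (a : A) : (MonoidalLeftAction.actionLeft M a).Linear k
  additive_right (m : M) : (MonoidalLeftAction.actionRight (C := A) m).Additive
  linear_right (m : M) : (MonoidalLeftAction.actionRight (C := A) m).Linear k
  preservesFiniteLimits (m : M) :
    PreservesFiniteLimits (MonoidalLeftAction.actionRight (C := A) m)
  preservesFiniteColimits (m : M) :
    PreservesFiniteColimits (MonoidalLeftAction.actionRight (C := A) m)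

/-- The action functor `M × B ⥤ M` of a right module category is `k`-bilinear, and it is exact in
the variable in `B`. -/
class IsLinearRightModule (k B M : Type*) [Field k] [Category* B] [Preadditive B] [Linear k B]
    [MonoidalCategory B] [Category* M] [Preadditive M] [Linear k M] [MonoidalRightAction B M] :
    Prop where
  additive_right (b : B) : (MonoidalRightAction.actionRight M b).Additive
  linear_right (b : B) : (MonoidalRightAction.actionRight M b).Linear k
  additive_left (m : M) : (MonoidalRightAction.actionLeft (C := B) m).Additive
  linear_left (m : M) : (MonoidalRightAction.actionLeft (C := B) m).Linear k
  preservesFiniteLimits (m : M) :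
    PreservesFiniteLimits (MonoidalRightAction.actionLeft (C := B) m)
  preservesFiniteColimits (m : M) :
    PreservesFiniteColimits (MonoidalRightAction.actionLeft (C := B) m)

section Transpose

variable (k : Type*) [Field k] {A B M : Type*} [Category* A] [Preadditive A] [Linear k A]
  [MonoidalCategory A] [Category* B] [Preadditive B] [Linear k B] [MonoidalCategory B]
  [Category* M] [Preadditive M] [Linear k M]

variable (A) in
/-- The canonical morphism `V ⊗ (c.x) ⟶ c.(V ⊗ x)`. -/
noncomputable def leftComparison [HasFiniteBiproducts M] [MonoidalLeftAction A M]
    [IsLinearLeftModule k A M] (V : Type*) [AddCommGroup V] [Module k V] [Module.Finite k V]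
    (c : A) (x : M) : copower k V (c ⊙ₗ x) ⟶ c ⊙ₗ copower k V x :=
  haveI := IsLinearLeftModule.additive_left (k := k) (M := M) c
  haveI := IsLinearLeftModule.linear_left (k := k) (M := M) c
  copower.comparison (MonoidalLeftAction.actionLeft M c) V x

variable (B) in
/-- The canonical morphism `V ⊗ (x.c) ⟶ (V ⊗ x).c`. -/
noncomputable def rightComparison [HasFiniteBiproducts M] [MonoidalRightAction B M]
    [IsLinearRightModule k B M] (V : Type*) [AddCommGroup V] [Module k V] [Module.Finite k V]
    (x : M) (c : B) : copower k V (x ⊙ᵣ c) ⟶ copower k V x ⊙ᵣ c :=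
  haveI := IsLinearRightModule.additive_right (k := k) (M := M) c
  haveI := IsLinearRightModule.linear_right (k := k) (M := M) c
  copower.comparison (MonoidalRightAction.actionRight M c) V x

/-- The linear map `Hom(aᘁᘁ.x, a.m) → Hom(x, m)` that sends `f` to
`x ⟶ aᘁ.(aᘁᘁ.x) ⟶ aᘁ.(a.m) ⟶ m`, where the outer morphisms are given by the coevaluation of `aᘁ`
and the evaluation of `a`. -/
def leftTranspose [RightRigidCategory A] [MonoidalLeftAction A M] [IsLinearLeftModule k A M]
    (a : A) (x m : M) :
    (rightDual (rightDual a) ⊙ₗ x ⟶ a ⊙ₗ m) →ₗ[k] (x ⟶ m) where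
  toFun f := (λₗ[A] x).inv ≫ η_ (rightDual a) (rightDual (rightDual a)) ⊵ₗ x ≫
    (αₗ (rightDual a) (rightDual (rightDual a)) x).hom ≫ rightDual a ⊴ₗ f ≫
    (αₗ (rightDual a) a m).inv ≫ ε_ a (rightDual a) ⊵ₗ m ≫ (λₗ[A] m).hom
  map_add' f g := by
    have := IsLinearLeftModule.additive_left (k := k) (M := M) (rightDual a)
    have h : rightDual a ⊴ₗ (f + g) = rightDual a ⊴ₗ f + rightDual a ⊴ₗ g :=
      (MonoidalLeftAction.actionLeft M (rightDual a)).map_add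
    simp only [h, Preadditive.add_comp, Preadditive.comp_add]
  map_smul' r f := by
    have := IsLinearLeftModule.linear_left (k := k) (M := M) (rightDual a)
    have h : rightDual a ⊴ₗ (r • f) = r • (rightDual a ⊴ₗ f) :=
      (MonoidalLeftAction.actionLeft M (rightDual a)).map_smul r f
    simp only [h, Linear.smul_comp, Linear.comp_smul, RingHom.id_apply]

/-- The linear map `Hom(x.ᘁᘁb, m.b) → Hom(x, m)` that sends `f` to
`x ⟶ (x.ᘁᘁb).ᘁb ⟶ (m.b).ᘁb ⟶ m`, where the outer morphisms are given by the coevaluation of `ᘁb`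
and the evaluation of `b`. -/
def rightTranspose [LeftRigidCategory B] [MonoidalRightAction B M] [IsLinearRightModule k B M]
    (x m : M) (b : B) :
    (x ⊙ᵣ leftDual (leftDual b) ⟶ m ⊙ᵣ b) →ₗ[k] (x ⟶ m) where
  toFun f := (ρᵣ[B] x).inv ≫ x ⊴ᵣ η_ (leftDual (leftDual b)) (leftDual b) ≫
    (αᵣ x (leftDual (leftDual b)) (leftDual b)).hom ≫ f ⊵ᵣ leftDual b ≫
    (αᵣ m b (leftDual b)).inv ≫ m ⊴ᵣ ε_ (leftDual b) b ≫ (ρᵣ[B] m).hom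
  map_add' f g := by
    have := IsLinearRightModule.additive_right (k := k) (M := M) (leftDual b)
    have h : (f + g) ⊵ᵣ leftDual b = f ⊵ᵣ leftDual b + g ⊵ᵣ leftDual b :=
      (MonoidalRightAction.actionRight M (leftDual b)).map_add
    simp only [h, Preadditive.add_comp, Preadditive.comp_add]
  map_smul' r f := by
    have := IsLinearRightModule.linear_right (k := k) (M := M) (leftDual b)
    have h : (r • f) ⊵ᵣ leftDual b = r • (f ⊵ᵣ leftDual b) :=
      (MonoidalRightAction.actionRight M (leftDual b)).map_smul r f
    simp only [h, Linear.smul_comp, Linear.comp_smul, RingHom.id_apply]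

end Transpose

section Canonical

universe w v u

variable {k : Type w} [Field k] {A B : Type*} [Category* A] [MonoidalCategory A]
  [Category* B] [MonoidalCategory B] {M : Type u} [Category.{v} M]

section

variable [RightRigidCategory A] [LeftRigidCategory B] [MonoidalLeftAction A M]
  [MonoidalRightAction B M] [BimoduleCategory A B M] (N : M ⥤ M)
  [BimoduleFunctor A B (N ⋙ toTwist A B M)]

variable (B) in
/-- The isomorphism `N(a.m) ≅ aᘁᘁ.N(m)` in `M` that belongs to a bimodule functor from `M` to its
twist. -/
def leftIso (a : A) (m : M) : N.obj (a ⊙ₗ m) ≅ rightDual (rightDual a) ⊙ₗ N.obj m :=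
  (Functor.LeftLinear.μₗIso (N ⋙ toTwist A B M) a m).symm

variable (A) in
/-- The isomorphism `N(m.b) ≅ N(m).ᘁᘁb` in `M` that belongs to a bimodule functor from `M` to its
twist. -/
def rightIso (m : M) (b : B) : N.obj (m ⊙ᵣ b) ≅ N.obj m ⊙ᵣ leftDual (leftDual b) :=
  (Functor.RightLinear.μᵣIso (N ⋙ toTwist A B M) m b).symm

end

/-- The bimodule functor structure on the Nakayama functor `N` is the canonical one: it is
compatible with the structure morphisms of the ends, in that the composites
`N(a.m) ≅ aᘁᘁ.N(m) ⟶ aᘁᘁ.(Hom(x, m) ⊗ x)` and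
`N(a.m) ⟶ Hom(aᘁᘁ.x, a.m) ⊗ (aᘁᘁ.x) ⟶ Hom(x, m) ⊗ (aᘁᘁ.x) ≅ aᘁᘁ.(Hom(x, m) ⊗ x)` agree, and
analogously for the right action. -/
structure IsCanonical [Abelian A] [Linear k A] [RightRigidCategory A] [Abelian B] [Linear k B]
    [LeftRigidCategory B] [Preadditive M] [Linear k M] [HasFiniteBiproducts M]
    [IsFiniteLinear k M] [MonoidalLeftAction A M] [MonoidalRightAction B M]
    [BimoduleCategory A B M] [IsLinearLeftModule k A M] [IsLinearRightModule k B M]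
    (E : NakayamaEnds k M) [BimoduleFunctor A B (E.functor ⋙ toTwist A B M)] : Prop where
  left (a : A) (m x : M) :
    (leftIso B E.functor a m).hom ≫ rightDual (rightDual a) ⊴ₗ E.proj m x =
      E.proj (a ⊙ₗ m) (rightDual (rightDual a) ⊙ₗ x) ≫
        copower.map (leftTranspose k a x m) (𝟙 _) ≫ leftComparison k A (x ⟶ m) _ x
  right (m x : M) (b : B) :
    (rightIso A E.functor m b).hom ≫ E.proj m x ⊵ᵣ leftDual (leftDual b) =
      E.proj (m ⊙ᵣ b) (x ⊙ᵣ leftDual (leftDual b)) ≫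
        copower.map (rightTranspose k x m b) (𝟙 _) ≫ rightComparison k B (x ⟶ m) x _

end Canonical

end Main

end FinTensor

/-!
Write `N(m)` for the end `∫_x Hom(x, m) ⊗ x`. A morphism into `V ⊗ x` is the same as a family of
morphisms into `x` that depends linearly on a functional on `V`. Hence a morphism `z ⟶ N(m)` is
the same as a family of morphisms `z ⟶ x`, one for each functional `ξ` on `Hom(x, m)`, which is
linear in `ξ` and natural in `x` (`FunctionalFamily`). The universal such family consists of the
components `π(x, ξ) : N(m) ⟶ x` (`NakayamaEnds.component`), and equations between morphisms into
`N(m)` become equations between functionals.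

For existence, let `G` be a separator. The functionals `h ↦ ξ(c ≫ h)` with `ξ` a functional on
`Hom(G, m)` and `c : G ⟶ x` span the dual of `Hom(x, m)`, so a natural family is determined by its
members at `G`, that is, by a morphism into `Hom(G, m) ⊗ G`. The end is the largest subobject of
this object on which the linear relations between these functionals hold
(`exists_largest_subobject`). It exists because a decreasing sequence of subobjects stops as soon
as the dimension of `Hom(G, -)` does.

The module structures come from a fact about chains of adjunctions `J ⊣ K ⊣ L ⊣ F` of linear
endofunctors: there is an isomorphism `N(F m) ≅ K N(m)` (`NakayamaEnds.comparisonIso`). It is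
characterized by the fact that its composite with `K π(x, ξ)` is `π(K x, ξ ∘ T)`, where `T : Hom(K
x, F m) → Hom(x, m)` is the transposition `f ↦ (x ⟶ L K x ⟶ L F m ⟶ m)`. The functor `J` enters
only through the fact that `K` preserves the end. When `F` is the action of `a`, the functors `L`
and `K` are the actions of `aᘁ` and `aᘁᘁ`, and `T` is the linear map in the definition of the
canonical structure.

By joint monicity of the components, each coherence axiom reduces to an identity between
transposition maps: dinaturality in the acting object (`transpose_mate`), multiplicativity
(`transpose_tensor`), unitality (`transpose_unit`) and, for the compatibility of the two actions,
the fact that transpositions on the left and on the right commute (`transpose_mid`). To keep the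
choice of duals flexible, the comparison isomorphisms are defined for objects with arbitrary
chosen double duals (`RightDualTriple`, `LeftDualTriple`): the tensor constraint of the double
dual functor is then the mate of an identity, and coherence for it is an instance of naturality.
-/

namespace FinTensor

/-! ### Coordinates on copowers -/

namespace copower

section

variable {k : Type*} [Field k] {C : Type*} [Category* C] [Preadditive C] [Linear k C]
  [HasFiniteBiproducts C]
  {V W : Type*} [AddCommGroup V] [Module k V] [Module.Finite k V]
  [AddCommGroup W] [Module k W] [Module.Finite k W]

/-- The morphism `ξ ⊗ y : V ⊗ y ⟶ k ⊗ y = y` given by a linear functional `ξ` on `V`. -/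
noncomputable def eval (ξ : Module.Dual k V) (y : C) : copower k V y ⟶ y :=
  desc ((LinearMap.toSpanSingleton k (y ⟶ y) (𝟙 y)).comp ξ)

lemma ι_eval (ξ : Module.Dual k V) (y : C) (v : V) : ι k V y v ≫ eval ξ y = ξ v • 𝟙 y := by
  simp [eval, ι_desc]

lemma eval_add (ξ η : Module.Dual k V) (y : C) : eval (ξ + η) y = eval ξ y + eval η y :=
  hom_ext fun v => by simp [ι_eval, add_smul]

lemma eval_smul (r : k) (ξ : Module.Dual k V) (y : C) : eval (r • ξ) y = r • eval ξ y :=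
  hom_ext fun v => by simp [ι_eval, mul_smul]

lemma map_eval (φ : V →ₗ[k] W) {y z : C} (g : y ⟶ z) (ξ : Module.Dual k W) :
    map φ g ≫ eval ξ z = eval (ξ.comp φ) y ≫ g :=
  hom_ext fun v => by
    rw [reassoc_of% ι_map, ι_eval, reassoc_of% ι_eval]
    simp

lemma eval_coord (i : Fin (Module.finrank k V)) (y : C) :
    eval ((Module.finBasis k V).coord i) y =
      biproduct.π (fun _ : Fin (Module.finrank k V) => y) i :=
  hom_ext fun v => by rw [ι_eval, ι_apply, biproduct.lift_π]; rfl

lemma hom_ext_eval {y z : C} {f g : z ⟶ copower k V y}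
    (h : ∀ ξ : Module.Dual k V, f ≫ eval ξ y = g ≫ eval ξ y) : f = g := by
  ext i
  simpa only [eval_coord] using h ((Module.finBasis k V).coord i)

/-- The morphism `z ⟶ V ⊗ y` with prescribed composites with the morphisms `ξ ⊗ y`. -/
noncomputable def lift {y z : C} (q : Module.Dual k V →ₗ[k] (z ⟶ y)) : z ⟶ copower k V y :=
  biproduct.lift fun i => q ((Module.finBasis k V).coord i)

/-- The composites of `g : z ⟶ V ⊗ y` with the morphisms `ξ ⊗ y`, as a linear function of `ξ`. -/
noncomputable def evalComp {y z : C} (g : z ⟶ copower k V y) : Module.Dual k V →ₗ[k] (z ⟶ y) where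
  toFun ξ := g ≫ eval ξ y
  map_add' ξ η := by rw [eval_add, Preadditive.comp_add]
  map_smul' r ξ := by rw [eval_smul, Linear.comp_smul]; rfl

lemma evalComp_lift {y z : C} (q : Module.Dual k V →ₗ[k] (z ⟶ y)) : evalComp (lift q) = q :=
  (Module.finBasis k V).dualBasis.ext fun i => by
    rw [Module.Basis.coe_dualBasis]
    change lift q ≫ eval ((Module.finBasis k V).coord i) y = q ((Module.finBasis k V).coord i)
    rw [eval_coord, lift, biproduct.lift_π]

lemma lift_eval {y z : C} (q : Module.Dual k V →ₗ[k] (z ⟶ y)) (ξ : Module.Dual k V) :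
    lift q ≫ eval ξ y = q ξ :=
  LinearMap.congr_fun (evalComp_lift q) ξ

/-- The canonical morphism `V ⊗ F y ⟶ F(V ⊗ y)` is compatible with evaluation at functionals. -/
lemma comparison_map_eval {D : Type*} [Category* D] [Preadditive D] [Linear k D]
    [HasFiniteBiproducts D] (F : C ⥤ D) [F.Additive] [F.Linear k] (ξ : Module.Dual k V) (y : C) :
    comparison F V y ≫ F.map (eval ξ y) = eval ξ (F.obj y) :=
  hom_ext fun v => by
    rw [comparison, reassoc_of% ι_desc, ι_eval]
    simp [← Functor.map_comp, ι_eval]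

/-- Additive functors preserve the finite biproduct `V ⊗ y`, so the morphisms `F(ξ ⊗ y)` are jointly
monic. -/
lemma hom_ext_map_eval {D : Type*} [Category* D] [Preadditive D] (F : C ⥤ D) [F.Additive] {y : C}
    {z : D} {f g : z ⟶ F.obj (copower k V y)}
    (h : ∀ ξ : Module.Dual k V, f ≫ F.map (eval ξ y) = g ≫ F.map (eval ξ y)) : f = g := by
  have key (u : z ⟶ F.obj (copower k V y)) : u = ∑ i, (u ≫ F.map
      (eval ((Module.finBasis k V).coord i) y)) ≫
        F.map (biproduct.ι (fun _ : Fin (Module.finrank k V) => y) i) := by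
    simp only [Category.assoc, ← Functor.map_comp, eval_coord, ← Preadditive.comp_sum,
      ← Functor.map_sum, biproduct.total]
    exact ((congrArg (u ≫ ·) (F.map_id _)).trans (Category.comp_id u)).symm
  rw [key f, key g]
  simp only [h]

end

end copower

/-! ### Components of the ends -/

section Components

universe w v u

variable {k : Type w} [Field k] {M : Type u} [Category.{v} M] [Preadditive M] [Linear k M]

/-- A linear family of morphisms `z ⟶ x` indexed by functionals on `Hom(x, m)` and natural in `x`.
Such families correspond to wedges with vertex `z` over `(x, y) ↦ Hom(x, m) ⊗ y`. -/
structure FunctionalFamily (k : Type w) [Field k] {M : Type u} [Category.{v} M] [Preadditive M]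
    [Linear k M] (m z : M) where
  app (x : M) : Module.Dual k (x ⟶ m) →ₗ[k] (z ⟶ x)
  naturality {x y : M} (f : x ⟶ y) (ξ : Module.Dual k (x ⟶ m)) :
    app x ξ ≫ f = app y (ξ.comp (Linear.leftComp k m f))

section Generator

variable (k) in
/-- The linear map that sends `ξ ⊗ c` to the functional `h ↦ ξ(c ≫ h)` on `Hom(x, m)`. -/
noncomputable def generatorFunctional (G m x : M) :
    TensorProduct k (Module.Dual k (G ⟶ m)) (G ⟶ x) →ₗ[k] Module.Dual k (x ⟶ m) :=
  TensorProduct.lift <| LinearMap.mk₂ k (fun ξ c => ξ.comp (Linear.leftComp k m c))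
    (fun _ _ _ => rfl) (fun _ _ _ => rfl)
    (fun ξ c d => LinearMap.ext fun h => by simp) (fun r ξ c => LinearMap.ext fun h => by simp)

@[simp]
lemma generatorFunctional_tmul (G m : M) {x : M} (ξ : Module.Dual k (G ⟶ m)) (c : G ⟶ x) :
    generatorFunctional k G m x (ξ ⊗ₜ c) = ξ.comp (Linear.leftComp k m c) :=
  rfl

lemma generatorFunctional_map (G m : M) {x y : M} (f : x ⟶ y)
    (t : TensorProduct k (Module.Dual k (G ⟶ m)) (G ⟶ x)) :
    generatorFunctional k G m y ((Linear.rightComp k G f).lTensor _ t) =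
      (generatorFunctional k G m x t).comp (Linear.leftComp k m f) := by
  induction t with
  | zero => simp
  | add s t hs ht => simp only [map_add, hs, ht, LinearMap.add_comp]
  | tmul ξ c => exact LinearMap.ext fun h => by simp

/-- For a morphism `Y ⟶ G` depending linearly on a functional on `Hom(G, m)`, the morphism
`Y ⟶ x` attached to `ξ ⊗ c` is the composite of the morphism at `ξ` with `c : G ⟶ x`. -/
noncomputable def generatorComponent {G m Y : M} (q : Module.Dual k (G ⟶ m) →ₗ[k] (Y ⟶ G))
    (x : M) : TensorProduct k (Module.Dual k (G ⟶ m)) (G ⟶ x) →ₗ[k] (Y ⟶ x) :=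
  TensorProduct.lift ((Linear.comp Y G x).comp q)

@[simp]
lemma generatorComponent_tmul {G m Y : M} (q : Module.Dual k (G ⟶ m) →ₗ[k] (Y ⟶ G)) {x : M}
    (ξ : Module.Dual k (G ⟶ m)) (c : G ⟶ x) :
    generatorComponent q x (ξ ⊗ₜ c) = q ξ ≫ c :=
  rfl

lemma generatorComponent_map {G m Y : M} (q : Module.Dual k (G ⟶ m) →ₗ[k] (Y ⟶ G)) {x y : M}
    (f : x ⟶ y) (t : TensorProduct k (Module.Dual k (G ⟶ m)) (G ⟶ x)) :
    generatorComponent q y ((Linear.rightComp k G f).lTensor _ t) =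
      generatorComponent q x t ≫ f := by
  induction t with
  | zero => simp
  | add s t hs ht => simp only [map_add, hs, ht, Preadditive.add_comp]
  | tmul ξ c => simp

/-- A natural family is determined by its members at a generator. -/
lemma FunctionalFamily.app_generatorFunctional {G m Y z : M}
    (q₀ : Module.Dual k (G ⟶ m) →ₗ[k] (Y ⟶ G)) (q : FunctionalFamily k m z) (g : z ⟶ Y)
    (hg : ∀ ξ, g ≫ q₀ ξ = q.app G ξ) (x : M)
    (t : TensorProduct k (Module.Dual k (G ⟶ m)) (G ⟶ x)) :
    q.app x (generatorFunctional k G m x t) = g ≫ generatorComponent q₀ x t := by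
  induction t with
  | zero => simp
  | add s t hs ht => simp only [map_add, hs, ht, Preadditive.comp_add]
  | tmul ξ c => rw [generatorFunctional_tmul, generatorComponent_tmul, ← q.naturality, ← hg,
      Category.assoc]

end Generator

section Separator

variable [IsFiniteLinear k M]

/-- Functionals of the form `h ↦ ξ(c ≫ h)` separate the elements of `Hom(x, m)`, hence span its
dual. -/
lemma generatorFunctional_surjective {G : M} (hG : IsSeparator G) (m x : M) :
    Function.Surjective (generatorFunctional k G m x) := by
  have h : (generatorFunctional k G m x).range.dualCoannihilator = ⊥ := by
    refine (Submodule.eq_bot_iff _).2 fun h hh => hG.def h 0 fun c => ?_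
    rw [comp_zero, ← Module.forall_dual_apply_eq_zero_iff k]
    intro ξ
    exact (Submodule.mem_dualCoannihilator _).1 hh _ ⟨ξ ⊗ₜ c, rfl⟩
  rw [← LinearMap.range_eq_top, ← Subspace.dualCoannihilator_dualAnnihilator_eq
    (W := (generatorFunctional k G m x).range), h, Submodule.dualAnnihilator_bot]

/-- Let `G` be a separator and `Y = Hom(G, m) ⊗ G`. There is a largest subobject of `Y` on which
all relations between the functionals `h ↦ ξ(c ≫ h)` hold: it is cut out by finitely many of them,
as one sees by minimizing the dimension of `Hom(G, K)` among the subobjects `K` of `Y` that contain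
the image of every morphism to `Y` that satisfies the relations. -/
lemma exists_largest_subobject [HasKernels M] {G : M} (hG : IsSeparator G) {m Y : M}
    (q₀ : Module.Dual k (G ⟶ m) →ₗ[k] (Y ⟶ G)) :
    ∃ (K : M) (i : K ⟶ Y), Mono i ∧
      (∀ x t, generatorFunctional k G m x t = 0 → i ≫ generatorComponent q₀ x t = 0) ∧
      ∀ {z : M} (g : z ⟶ Y),
        (∀ x t, generatorFunctional k G m x t = 0 → g ≫ generatorComponent q₀ x t = 0) →
          ∃ l, l ≫ i = g := by
  let Q (n : ℕ) : Prop := ∃ (K : M) (i : K ⟶ Y), Mono i ∧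
      (∀ {z : M} (g : z ⟶ Y),
        (∀ x t, generatorFunctional k G m x t = 0 → g ≫ generatorComponent q₀ x t = 0) →
          ∃ l, l ≫ i = g) ∧ Module.finrank k (G ⟶ K) = n
  have hQ : ∃ n, Q n := ⟨_, Y, 𝟙 Y, inferInstance, fun g _ => ⟨g, Category.comp_id g⟩, rfl⟩
  classical
  obtain ⟨K, i, hi, hK, hn⟩ := Nat.find_spec hQ
  refine ⟨K, i, hi, fun x t ht => ?_, hK⟩
  let r := i ≫ generatorComponent q₀ x t
  have hmin : Module.finrank k (G ⟶ K) ≤ Module.finrank k (G ⟶ kernel r) := by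
    rw [hn]
    refine Nat.find_min' hQ ⟨kernel r, kernel.ι r ≫ i, mono_comp _ _, fun g hg => ?_, rfl⟩
    obtain ⟨l, rfl⟩ := hK g hg
    exact ⟨kernel.lift r l (by simpa only [r, Category.assoc] using hg x t ht), by simp⟩
  have hinj : Function.Injective (Linear.rightComp k G (kernel.ι r)) :=
    fun _ _ h => (cancel_mono (kernel.ι r)).1 h
  have hsurj : Function.Surjective (Linear.rightComp k G (kernel.ι r)) :=
    (LinearMap.injective_iff_surjective_of_finrank_eq_finrank
      (le_antisymm (LinearMap.finrank_le_finrank_of_injective hinj) hmin)).1 hinj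
  refine hG.def r 0 fun h => ?_
  obtain ⟨h', rfl⟩ := hsurj h
  simp

lemma exists_isSeparator (k : Type w) [Field k] (M : Type u) [Category.{v} M] [Preadditive M]
    [Linear k M] [IsFiniteLinear k M] : ∃ G : M, IsSeparator G := by
  obtain ⟨R, _, _, _, E, _, _⟩ := IsFiniteLinear.exists_equivalence (k := k) (C := M)
  have h : IsSeparator (FGModuleCat.of R R) := (isSeparator_def _).2 fun X Y f g h => by
    ext x
    have := h (FGModuleCat.ofHom (LinearMap.toSpanSingleton R X x))
    have h₁ : f.hom.hom ((1 : R) • x) = g.hom.hom ((1 : R) • x) :=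
      congrArg (fun t => t.hom.hom (1 : R)) this
    simpa only [one_smul] using h₁
  exact ⟨_, h.of_equivalence E.symm⟩

end Separator

variable [HasFiniteBiproducts M] [IsFiniteLinear k M]

namespace FunctionalFamily

variable {m z : M}

lemma lift_app_dinatural (q : FunctionalFamily k m z) {x y : M} (f : x ⟶ y) :
    copower.lift (q.app x) ≫ copower.map LinearMap.id f =
      copower.lift (q.app y) ≫ copower.map (Linear.leftComp k m f) (𝟙 y) :=
  copower.hom_ext_eval fun ξ => by
    simp only [Category.assoc, copower.map_eval, Category.comp_id, copower.lift_eval,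
      reassoc_of% copower.lift_eval, LinearMap.comp_id, q.naturality]

end FunctionalFamily

namespace NakayamaEnds

variable (E : NakayamaEnds k M)

/-- The component `∫_x Hom(x, m) ⊗ x ⟶ x` of the end at a functional `ξ` on `Hom(x, m)`. -/
noncomputable def component (m x : M) : Module.Dual k (x ⟶ m) →ₗ[k] (E.functor.obj m ⟶ x) :=
  copower.evalComp (E.proj m x)

lemma component_naturality (m : M) {x y : M} (f : x ⟶ y) (ξ : Module.Dual k (x ⟶ m)) :
    E.component m x ξ ≫ f = E.component m y (ξ.comp (Linear.leftComp k m f)) := by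
  have h := E.proj_dinatural m f =≫ copower.eval ξ y
  simp only [Category.assoc, copower.map_eval, LinearMap.comp_id, Category.comp_id] at h
  exact (Category.assoc _ _ _).trans h

lemma hom_ext_component {m z : M} {f g : z ⟶ E.functor.obj m}
    (h : ∀ x ξ, f ≫ E.component m x ξ = g ≫ E.component m x ξ) : f = g :=
  E.hom_ext fun x => copower.hom_ext_eval fun ξ =>
    (Category.assoc _ _ _).trans ((h x ξ).trans (Category.assoc _ _ _).symm)

lemma map_component {m m' : M} (f : m ⟶ m') (x : M) (ξ : Module.Dual k (x ⟶ m')) :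
    E.functor.map f ≫ E.component m' x ξ =
      E.component m x (ξ.comp (Linear.rightComp k x f)) := by
  have h := E.map_proj f x =≫ copower.eval ξ x
  rw [Category.assoc, Category.assoc, copower.map_eval, Category.comp_id] at h
  exact h

/-- The morphism into the end with prescribed components. -/
noncomputable def lift {m z : M} (q : FunctionalFamily k m z) : z ⟶ E.functor.obj m :=
  Wedge.IsLimit.lift (E.isLimit m) (fun x => copower.lift (q.app x))
    fun _ _ f => q.lift_app_dinatural f

lemma lift_component {m z : M} (q : FunctionalFamily k m z) (x : M)
    (ξ : Module.Dual k (x ⟶ m)) : E.lift q ≫ E.component m x ξ = q.app x ξ := by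
  have h : E.lift q ≫ E.proj m x = copower.lift (q.app x) :=
    Wedge.IsLimit.lift_ι (E.isLimit m) _ _ x
  exact (Category.assoc _ _ _).symm.trans
    ((congrArg (· ≫ copower.eval ξ x) h).trans (copower.lift_eval _ _))

lemma functor_additive : E.functor.Additive where
  map_add {m m' f g} := E.hom_ext_component fun x ξ => by
    rw [Preadditive.add_comp]
    simp only [map_component, ← map_add]
    exact congrArg _ (LinearMap.ext fun t => by simp)

lemma functor_linear : E.functor.Linear k where
  map_smul {m m'} f r := E.hom_ext_component fun x ξ => by
    rw [Linear.smul_comp]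
    simp only [map_component, ← map_smul]
    exact congrArg _ (LinearMap.ext fun t => by simp)

end NakayamaEnds

/-! ### Existence of the ends -/

/-- The leg `s ⟶ Hom(x, m) ⊗ x` of a wedge. -/
noncomputable def wedgeLeg {m : M} (s : Wedge (nakayamaIntegrand k m)) (x : M) :
    s.pt ⟶ copower k (x ⟶ m) x :=
  s.ι x

lemma wedgeLeg_dinatural {m : M} (s : Wedge (nakayamaIntegrand k m)) {x y : M} (f : x ⟶ y) :
    wedgeLeg s x ≫ copower.map LinearMap.id f =
      wedgeLeg s y ≫ copower.map (Linear.leftComp k m f) (𝟙 y) :=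
  s.condition f

/-- A universal family of components provides the end. -/
lemma exists_isLimit_wedge {m N : M} (p : FunctionalFamily k m N)
    (mono : ∀ {z : M} (f g : z ⟶ N), (∀ x ξ, f ≫ p.app x ξ = g ≫ p.app x ξ) → f = g)
    (exists_lift : ∀ {z : M} (q : FunctionalFamily k m z),
      ∃ l : z ⟶ N, ∀ x ξ, l ≫ p.app x ξ = q.app x ξ) :
    ∃ W : Wedge (nakayamaIntegrand k m), Nonempty (IsLimit W) := by
  let fam (s : Wedge (nakayamaIntegrand k m)) : FunctionalFamily k m s.pt :=
    { app x := copower.evalComp (wedgeLeg s x)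
      naturality {x y} f ξ := by
        have h := wedgeLeg_dinatural s f =≫ copower.eval ξ y
        simp only [Category.assoc, copower.map_eval, LinearMap.comp_id, Category.comp_id] at h
        exact (Category.assoc _ _ _).trans h }
  choose l hl using fun s => exists_lift (fam s)
  have fac (s : Wedge (nakayamaIntegrand k m)) (x : M) :
      l s ≫ copower.lift (p.app x) = wedgeLeg s x :=
    copower.hom_ext_eval fun ξ => by
      rw [Category.assoc, copower.lift_eval]
      exact hl s x ξ
  refine ⟨Wedge.mk N (fun x => copower.lift (p.app x)) fun _ _ f => p.lift_app_dinatural f,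
    ⟨Multifork.IsLimit.mk _ l fac fun s f hf => mono _ _ fun x ξ => ?_⟩⟩
  rw [hl, ← copower.lift_eval (p.app x) ξ]
  exact (Category.assoc _ _ _).symm.trans (congrArg (· ≫ copower.eval ξ x) (hf x))

section Separator

/-- The end is the largest subobject `K` of `Hom(G, m) ⊗ G` on which the relations between
functionals hold: on `K`, the members at the separator `G` extend to a natural family, and every
natural family factors through `K` by its members at `G`. -/
lemma exists_wedge_of_isSeparator [HasKernels M] {G : M} (hG : IsSeparator G) (m : M) :
    ∃ W : Wedge (nakayamaIntegrand k m), Nonempty (IsLimit W) := by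
  let q₀ : Module.Dual k (G ⟶ m) →ₗ[k] (copower k (G ⟶ m) G ⟶ G) := copower.evalComp (𝟙 _)
  have hq₀ {z : M} (g : z ⟶ copower k (G ⟶ m) G) (ξ : Module.Dual k (G ⟶ m)) :
      g ≫ q₀ ξ = g ≫ copower.eval ξ G := congrArg (g ≫ ·) (Category.id_comp _)
  obtain ⟨K, i, hi, hiK, hK⟩ := exists_largest_subobject hG q₀
  -- Functionals on `Hom(x, m)` are lifted linearly to tensors; by `hs''`, the choice of the lift
  -- does not matter on `K`.
  choose s hs using fun x => (generatorFunctional k G m x).exists_rightInverse_of_surjective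
    (LinearMap.range_eq_top.2 (generatorFunctional_surjective hG m x))
  have hs' (x : M) (ξ) : generatorFunctional k G m x (s x ξ) = ξ := LinearMap.congr_fun (hs x) ξ
  have hs'' (x : M) (t) : i ≫ generatorComponent q₀ x (s x (generatorFunctional k G m x t)) =
      i ≫ generatorComponent q₀ x t := by
    rw [← sub_eq_zero, ← Preadditive.comp_sub, ← map_sub]
    exact hiK x _ (by rw [map_sub, hs', sub_self])
  let p : FunctionalFamily k m K :=
    { app x := (Linear.leftComp k x i).comp ((generatorComponent q₀ x).comp (s x))
      naturality {x y} f ξ := by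
        have h := hs'' y ((Linear.rightComp k G f).lTensor _ (s x ξ))
        rw [generatorFunctional_map, hs', generatorComponent_map] at h
        exact (Category.assoc _ _ _).trans h.symm }
  have hp (x : M) (ξ) : p.app x ξ = i ≫ generatorComponent q₀ x (s x ξ) := rfl
  refine exists_isLimit_wedge p (fun {z} f g h => ?_) (fun {z} q => ?_)
  · rw [← cancel_mono i]
    refine copower.hom_ext_eval fun ξ => ?_
    have h' := h G (generatorFunctional k G m G (ξ ⊗ₜ 𝟙 G))
    rw [hp, hs'', generatorComponent_tmul, Category.comp_id] at h'
    rw [← hq₀, ← hq₀, Category.assoc, Category.assoc, h']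
  · have hg (ξ) : copower.lift (q.app G) ≫ q₀ ξ = q.app G ξ := by
      rw [hq₀, copower.lift_eval]
    obtain ⟨l, hl⟩ := hK (copower.lift (q.app G)) fun x t ht => by
      rw [← q.app_generatorFunctional q₀ _ hg, ht, map_zero]
    refine ⟨l, fun x ξ => ?_⟩
    rw [hp, reassoc_of% hl, ← q.app_generatorFunctional q₀ _ hg, hs']

variable (k M) in
lemma nonempty_nakayamaEnds [HasKernels M] : Nonempty (NakayamaEnds k M) := by
  obtain ⟨G, hG⟩ := exists_isSeparator k M
  choose W hW using fun m : M => exists_wedge_of_isSeparator (k := k) hG m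
  exact ⟨⟨W, fun m => (hW m).some⟩⟩

end Separator

end Components


/-! ### Nakayama functors and chains of adjunctions -/

section AdjointChain

universe w v u

variable {k : Type w} [Field k] {M : Type u} [Category.{v} M] [Preadditive M] [Linear k M]
  {F L K J : M ⥤ M}

variable (k) in
/-- For adjunctions `K ⊣ L ⊣ F`, the linear map `Hom(K x, F m) → Hom(x, m)` that sends `f` to
`x ⟶ L K x ⟶ L F m ⟶ m`. -/
def adjTranspose (adj₁ : L ⊣ F) (adj₂ : K ⊣ L) [L.Additive] [L.Linear k] (x m : M) :
    (K.obj x ⟶ F.obj m) →ₗ[k] (x ⟶ m) where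
  toFun f := adj₂.unit.app x ≫ L.map f ≫ adj₁.counit.app m
  map_add' f g := by simp only [L.map_add, Preadditive.add_comp, Preadditive.comp_add]
  map_smul' r f := by
    simp only [L.map_smul, Linear.smul_comp, Linear.comp_smul, RingHom.id_apply]

lemma adjTranspose_apply (adj₁ : L ⊣ F) (adj₂ : K ⊣ L) [L.Additive] [L.Linear k] {x m : M}
    (f : K.obj x ⟶ F.obj m) :
    adjTranspose k adj₁ adj₂ x m f = adj₂.unit.app x ≫ L.map f ≫ adj₁.counit.app m :=
  rfl

lemma adjTranspose_map_comp (adj₁ : L ⊣ F) (adj₂ : K ⊣ L) [L.Additive] [L.Linear k] {x y m : M}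
    (g : x ⟶ y) (f : K.obj y ⟶ F.obj m) :
    adjTranspose k adj₁ adj₂ x m (K.map g ≫ f) = g ≫ adjTranspose k adj₁ adj₂ y m f := by
  simp only [adjTranspose_apply, Functor.map_comp, Category.assoc]
  exact adj₂.unit_naturality_assoc g (L.map f ≫ adj₁.counit.app m)

variable (k) in
/-- The linear map `Hom(L x, m) → Hom(x, F m)` of an adjunction `L ⊣ F`. -/
def adjHom (adj : L ⊣ F) [F.Additive] [F.Linear k] (x m : M) :
    (L.obj x ⟶ m) →ₗ[k] (x ⟶ F.obj m) where
  toFun f := adj.unit.app x ≫ F.map f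
  map_add' f g := by simp only [F.map_add, Preadditive.comp_add]
  map_smul' r f := by simp only [F.map_smul, Linear.comp_smul, RingHom.id_apply]

lemma adjHom_apply (adj : L ⊣ F) [F.Additive] [F.Linear k] {x m : M} (f : L.obj x ⟶ m) :
    adjHom k adj x m f = adj.unit.app x ≫ F.map f :=
  rfl

variable (k) in
/-- The linear map `Hom(x, F m) → Hom(L x, m)` of an adjunction `L ⊣ F`. -/
def adjHomSymm (adj : L ⊣ F) [L.Additive] [L.Linear k] (x m : M) :
    (x ⟶ F.obj m) →ₗ[k] (L.obj x ⟶ m) where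
  toFun f := (adj.homEquiv x m).symm f
  map_add' f g := by
    simp only [Adjunction.homEquiv_counit, L.map_add, Preadditive.add_comp]
  map_smul' r f := by
    simp only [Adjunction.homEquiv_counit, L.map_smul, Linear.smul_comp, RingHom.id_apply]

lemma adjTranspose_adjHom (adj₁ : L ⊣ F) (adj₂ : K ⊣ L) [L.Additive] [L.Linear k] [F.Additive]
    [F.Linear k] {x m : M} (h : L.obj (K.obj x) ⟶ m) :
    adjTranspose k adj₁ adj₂ x m (adjHom k adj₁ (K.obj x) m h) = adj₂.unit.app x ≫ h := by
  simp [adjTranspose_apply, adjHom_apply]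

lemma adjHom_adjTranspose (adj₁ : L ⊣ F) (adj₂ : K ⊣ L) [L.Additive] [L.Linear k] [F.Additive]
    [F.Linear k] {x m : M} (g : x ⟶ F.obj m) :
    adjHom k adj₁ x m (adjTranspose k adj₁ adj₂ (L.obj x) m (adj₂.counit.app x ≫ g)) = g := by
  simp [adjTranspose_apply, adjHom_apply]

variable [HasFiniteBiproducts M] [IsFiniteLinear k M]

namespace NakayamaEnds

variable (E : NakayamaEnds k M)

/-- A functor `K` with a left adjoint preserves the end, so its values on the components of the
end are jointly monic. -/
lemma hom_ext_map_component (adj₃ : J ⊣ K) {m z : M} {f g : z ⟶ K.obj (E.functor.obj m)}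
    (h : ∀ x ξ, f ≫ K.map (E.component m x ξ) = g ≫ K.map (E.component m x ξ)) : f = g := by
  apply (adj₃.homEquiv z _).symm.injective
  refine E.hom_ext_component fun x ξ => ?_
  have h' := congrArg (adj₃.homEquiv z x).symm (h x ξ)
  rwa [adj₃.homEquiv_naturality_right_symm, adj₃.homEquiv_naturality_right_symm] at h'

/-- A functor `K` with a left adjoint preserves the end, so morphisms to its value on the end can
be given by their components. -/
lemma exists_lift_map_component (adj₃ : J ⊣ K) [J.Additive] [J.Linear k] {m z : M}
    (q : (x : M) → Module.Dual k (x ⟶ m) →ₗ[k] (z ⟶ K.obj x))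
    (hq : ∀ {x y : M} (f : x ⟶ y) (ξ : Module.Dual k (x ⟶ m)),
      q x ξ ≫ K.map f = q y (ξ.comp (Linear.leftComp k m f))) :
    ∃ l : z ⟶ K.obj (E.functor.obj m), ∀ x ξ, l ≫ K.map (E.component m x ξ) = q x ξ := by
  let q' : FunctionalFamily k m (J.obj z) :=
    { app x := (adjHomSymm k adj₃ z x).comp (q x)
      naturality {x y} f ξ := by
        change (adj₃.homEquiv z x).symm (q x ξ) ≫ f = (adj₃.homEquiv z y).symm (q y _)
        rw [← hq, adj₃.homEquiv_naturality_right_symm] }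
  refine ⟨adj₃.homEquiv _ _ (E.lift q'), fun x ξ => ?_⟩
  rw [← adj₃.homEquiv_naturality_right, E.lift_component]
  exact Equiv.apply_symm_apply _ _

/-- The family `π(K x, ξ ∘ T)`, with `T` the transposition `Hom(K x, F m) → Hom(x, m)`, is natural
in `x` and hence defines a morphism `N(F m) ⟶ K N(m)`. -/
lemma exists_comparison (adj₁ : L ⊣ F) (adj₂ : K ⊣ L) (adj₃ : J ⊣ K) [L.Additive] [L.Linear k]
    [J.Additive] [J.Linear k] (m : M) :
    ∃ l : E.functor.obj (F.obj m) ⟶ K.obj (E.functor.obj m),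
      ∀ x ξ, l ≫ K.map (E.component m x ξ) =
        E.component (F.obj m) (K.obj x) (ξ.comp (adjTranspose k adj₁ adj₂ x m)) := by
  refine E.exists_lift_map_component adj₃ (z := E.functor.obj (F.obj m))
    (fun x => (E.component (F.obj m) (K.obj x)).comp (adjTranspose k adj₁ adj₂ x m).dualMap)
    fun {x y} f ξ => ?_
  refine (E.component_naturality _ _ _).trans (congrArg _ (LinearMap.ext fun g => ?_))
  exact congrArg ξ (adjTranspose_map_comp adj₁ adj₂ f g)

variable (adj₁ : L ⊣ F) (adj₂ : K ⊣ L) (adj₃ : J ⊣ K) [F.Additive] [F.Linear k] [L.Additive]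
  [L.Linear k] [K.Additive] [K.Linear k] [J.Additive] [J.Linear k]

/-- The family of morphisms `K N(m) ⟶ K L x ⟶ x` that defines `K N(m) ⟶ N(F m)`. -/
noncomputable def comparisonInvFamily (m : M) :
    FunctionalFamily k (F.obj m) (K.obj (E.functor.obj m)) where
  app x := (adjHomSymm k adj₂ _ x).comp
    ((E.component m (L.obj x)).comp (adjHom k adj₁ x m).dualMap)
  naturality {x y} f ξ := by
    change (adj₂.homEquiv _ x).symm (E.component m (L.obj x) _) ≫ f =
      (adj₂.homEquiv _ y).symm (E.component m (L.obj y) _)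
    rw [← adj₂.homEquiv_naturality_right_symm, E.component_naturality]
    refine congrArg (fun t => (adj₂.homEquiv _ y).symm (E.component m (L.obj y) t))
      (LinearMap.ext fun g => congrArg ξ ?_)
    simp [adjHom_apply]

/-- For adjunctions `J ⊣ K ⊣ L ⊣ F` of linear functors, the isomorphism `N(F m) ≅ K N(m)`. -/
noncomputable def comparisonIso (m : M) :
    E.functor.obj (F.obj m) ≅ K.obj (E.functor.obj m) where
  hom := (E.exists_comparison adj₁ adj₂ adj₃ m).choose
  inv := E.lift (E.comparisonInvFamily adj₁ adj₂ m)
  hom_inv_id := by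
    have hΦ := (E.exists_comparison adj₁ adj₂ adj₃ m).choose_spec
    generalize (E.exists_comparison adj₁ adj₂ adj₃ m).choose = Φ at hΦ ⊢
    refine E.hom_ext_component fun x ξ => ?_
    rw [Category.assoc, E.lift_component, Category.id_comp]
    change Φ ≫ (adj₂.homEquiv _ x).symm (E.component m (L.obj x) _) = _
    rw [adj₂.homEquiv_counit, reassoc_of% hΦ]
    refine (E.component_naturality _ _ _).trans (congrArg _ (LinearMap.ext fun g => ?_))
    exact congrArg ξ (adjHom_adjTranspose adj₁ adj₂ g)
  inv_hom_id := by
    have hΦ := (E.exists_comparison adj₁ adj₂ adj₃ m).choose_spec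
    generalize (E.exists_comparison adj₁ adj₂ adj₃ m).choose = Φ at hΦ ⊢
    refine E.hom_ext_map_component adj₃ fun x ξ => ?_
    rw [Category.assoc, hΦ, E.lift_component, Category.id_comp]
    change (adj₂.homEquiv _ (K.obj x)).symm (E.component m (L.obj (K.obj x)) _) = _
    rw [Equiv.symm_apply_eq, adj₂.homEquiv_unit, adj₂.unit_naturality]
    refine Eq.trans (congrArg _ (LinearMap.ext fun g => ?_)) (E.component_naturality _ _ _).symm
    exact congrArg ξ (adjTranspose_adjHom adj₁ adj₂ g)

lemma comparisonIso_hom_map_component (m x : M) (ξ : Module.Dual k (x ⟶ m)) :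
    (E.comparisonIso adj₁ adj₂ adj₃ m).hom ≫ K.map (E.component m x ξ) =
      E.component (F.obj m) (K.obj x) (ξ.comp (adjTranspose k adj₁ adj₂ x m)) :=
  (E.exists_comparison adj₁ adj₂ adj₃ m).choose_spec x ξ

end NakayamaEnds

end AdjointChain


/-! ### Duality in module categories -/

section ExactPairing

variable {C : Type*} [Category* C] [MonoidalCategory C]

lemma tensor_coevaluation_eq {X₁ X₂ Y₁ Y₂ : C} [ExactPairing X₁ Y₁] [ExactPairing X₂ Y₂] :
    η_ (X₁ ⊗ X₂) (Y₂ ⊗ Y₁) = η_ X₁ Y₁ ≫ X₁ ◁ (λ_ Y₁).inv ≫ X₁ ◁ η_ X₂ Y₂ ▷ Y₁ ≫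
      X₁ ◁ (α_ X₂ Y₂ Y₁).hom ≫ (α_ X₁ X₂ (Y₂ ⊗ Y₁)).inv := by
  rw [ExactPairing.tensor_coevaluation]
  monoidal

lemma tensor_evaluation_eq {X₁ X₂ Y₁ Y₂ : C} [ExactPairing X₁ Y₁] [ExactPairing X₂ Y₂] :
    ε_ (X₁ ⊗ X₂) (Y₂ ⊗ Y₁) = (α_ Y₂ Y₁ (X₁ ⊗ X₂)).hom ≫ Y₂ ◁ (α_ Y₁ X₁ X₂).inv ≫
      Y₂ ◁ ε_ X₁ Y₁ ▷ X₂ ≫ Y₂ ◁ (λ_ X₂).hom ≫ ε_ X₂ Y₂ := by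
  rw [ExactPairing.tensor_evaluation]
  monoidal

end ExactPairing

section LeftAction

open MonoidalLeftAction

variable {C M : Type*} [Category* C] [MonoidalCategory C] [Category* M] [MonoidalLeftAction C M]

lemma associator_hom_actionHomLeft (c₁ c₂ c₃ : C) (m : M) :
    (α_ c₁ c₂ c₃).hom ⊵ₗ m = (αₗ (c₁ ⊗ c₂) c₃ m).hom ≫ (αₗ c₁ c₂ (c₃ ⊙ₗ m)).hom ≫
      c₁ ⊴ₗ (αₗ c₂ c₃ m).inv ≫ (αₗ c₁ (c₂ ⊗ c₃) m).inv := by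
  simp [← associator_actionHom_assoc]

lemma associator_inv_actionHomLeft (c₁ c₂ c₃ : C) (m : M) :
    (α_ c₁ c₂ c₃).inv ⊵ₗ m = (αₗ c₁ (c₂ ⊗ c₃) m).hom ≫ c₁ ⊴ₗ (αₗ c₂ c₃ m).hom ≫
      (αₗ c₁ c₂ (c₃ ⊙ₗ m)).inv ≫ (αₗ (c₁ ⊗ c₂) c₃ m).inv := by
  rw [← cancel_epi ((α_ c₁ c₂ c₃).hom ⊵ₗ m), hom_inv_actionHomLeft]
  simp [associator_hom_actionHomLeft]

lemma leftUnitor_inv_actionHomLeft (c : C) (m : M) :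
    (λ_ c).inv ⊵ₗ m = (λₗ[C] (c ⊙ₗ m)).inv ≫ (αₗ (𝟙_ C) c m).inv := by
  rw [← cancel_epi ((λ_ c).hom ⊵ₗ m), hom_inv_actionHomLeft]
  simp

lemma rightUnitor_inv_actionHomLeft (c : C) (m : M) :
    (ρ_ c).inv ⊵ₗ m = c ⊴ₗ (λₗ[C] m).inv ≫ (αₗ c (𝟙_ C) m).inv := by
  rw [← cancel_epi ((ρ_ c).hom ⊵ₗ m), hom_inv_actionHomLeft]
  simp

attribute [local simp] whiskerRight_actionHomLeft associator_hom_actionHomLeft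
  associator_inv_actionHomLeft leftUnitor_inv_actionHomLeft rightUnitor_inv_actionHomLeft

-- This rewrites `f ⊵ₗ (X ⊙ₗ m)` in the direction opposite to `whiskerRight_actionHomLeft`.
attribute [-simp] actionHomLeft_action

/-- The unit `m ⟶ X.(X'.m)` of the adjunction between the actions of `X'` and `X`. -/
def leftUnit {X X' : C} (p : ExactPairing X X') (m : M) : m ⟶ X ⊙ₗ X' ⊙ₗ m :=
  (λₗ[C] m).inv ≫ η_ X X' ⊵ₗ m ≫ (αₗ X X' m).hom

/-- The counit `X'.(X.m) ⟶ m` of the adjunction between the actions of `X'` and `X`. -/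
def leftCounit {X X' : C} (p : ExactPairing X X') (m : M) : X' ⊙ₗ X ⊙ₗ m ⟶ m :=
  (αₗ X' X m).inv ≫ ε_ X X' ⊵ₗ m ≫ (λₗ[C] m).hom

lemma leftUnit_naturality {X X' : C} (p : ExactPairing X X') {m n : M} (f : m ⟶ n) :
    leftUnit p m ≫ X ⊴ₗ X' ⊴ₗ f = f ≫ leftUnit p n := by
  have h := action_exchange (η_ X X') f
  simp only [tensor_actionHomRight, unit_actionHomRight, Category.assoc] at h
  have h' := (λₗ[C] m).inv ≫= h =≫ (αₗ X X' n).hom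
  simp only [Category.assoc, Iso.inv_hom_id_assoc, Iso.inv_hom_id, Category.comp_id] at h'
  simp only [leftUnit, Category.assoc, h']

lemma leftCounit_naturality {X X' : C} (p : ExactPairing X X') {m n : M} (f : m ⟶ n) :
    X' ⊴ₗ X ⊴ₗ f ≫ leftCounit p n = leftCounit p m ≫ f := by
  have h := action_exchange (ε_ X X') f
  simp only [tensor_actionHomRight, unit_actionHomRight, Category.assoc] at h
  have h' := (αₗ X' X m).inv ≫= h =≫ (λₗ[C] n).hom
  simp only [Category.assoc, Iso.inv_hom_id_assoc, Iso.inv_hom_id, Category.comp_id] at h'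
  simp only [leftCounit, Category.assoc, h']

lemma leftUnit_leftCounit {X X' : C} (p : ExactPairing X X') (m : M) :
    X' ⊴ₗ leftUnit p m ≫ leftCounit p (X' ⊙ₗ m) = 𝟙 _ := by
  have h := (X' ⊴ₗ (λₗ[C] m).inv ≫ (αₗ X' (𝟙_ C) m).inv) ≫=
    congrArg (fun t => t ⊵ₗ m) (ExactPairing.coevaluation_evaluation X X') =≫
      ((αₗ _ _ _).hom ≫ (λₗ[C] _).hom)
  simpa [leftUnit, leftCounit, -ExactPairing.coevaluation_evaluation,
    -ExactPairing.evaluation_coevaluation] using h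

lemma leftUnit_leftCounit' {X X' : C} (p : ExactPairing X X') (m : M) :
    leftUnit p (X ⊙ₗ m) ≫ X ⊴ₗ leftCounit p m = 𝟙 _ := by
  have h := ((λₗ[C] _).inv ≫ (αₗ (𝟙_ C) X m).inv) ≫=
    congrArg (fun t => t ⊵ₗ m) (ExactPairing.evaluation_coevaluation X X') =≫
      ((αₗ _ _ _).hom ≫ X ⊴ₗ (λₗ[C] m).hom)
  simpa [leftUnit, leftCounit, -ExactPairing.coevaluation_evaluation,
    -ExactPairing.evaluation_coevaluation] using h

/-- An exact pairing of `X` and `X'` makes the action of `X'` left adjoint to that of `X`. -/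
def leftAdjunction {X X' : C} (p : ExactPairing X X') :
    MonoidalLeftAction.actionLeft M X' ⊣ MonoidalLeftAction.actionLeft M X where
  unit := { app := leftUnit p, naturality _ _ f := (leftUnit_naturality p f).symm }
  counit := { app := leftCounit p, naturality _ _ f := leftCounit_naturality p f }
  left_triangle_components m := leftUnit_leftCounit p m
  right_triangle_components m := leftUnit_leftCounit' p m

lemma leftUnit_rightMate {X X' Y Y' : C} (p : ExactPairing X X') (q : ExactPairing Y Y')
    (f : X ⟶ Y) (m : M) :
    leftUnit p m ≫ f ⊵ₗ (X' ⊙ₗ m) = leftUnit q m ≫ Y ⊴ₗ rightMate p q f ⊵ₗ m := by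
  have h : η_ Y Y' ≫ Y ◁ rightMate p q f = η_ X X' ≫ f ▷ X' :=
    @coevaluation_comp_rightAdjointMate C _ _ X Y (@HasRightDual.mk _ _ _ X X' p)
      (@HasRightDual.mk _ _ _ Y Y' q) f
  have h' := (λₗ[C] m).inv ≫= congrArg (fun t => t ⊵ₗ m) h =≫ (αₗ _ _ _).hom
  simpa [leftUnit] using h'.symm

lemma leftCounit_rightMate {X X' Y Y' : C} (p : ExactPairing X X') (q : ExactPairing Y Y')
    (f : X ⟶ Y) (m : M) :
    rightMate p q f ⊵ₗ (X ⊙ₗ m) ≫ leftCounit p m = Y' ⊴ₗ f ⊵ₗ m ≫ leftCounit q m := by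
  have h := (αₗ _ _ _).inv ≫= congrArg (fun t => t ⊵ₗ m) (rightMate_evaluation p q f) =≫
    (λₗ[C] m).hom
  simpa [leftCounit] using h

lemma leftUnit_tensor {X₁ X₂ Y₁ Y₂ : C} (p : ExactPairing X₁ Y₁) (q : ExactPairing X₂ Y₂) (m : M) :
    leftUnit (ExactPairing.tensor (X₁ := X₁) (X₂ := X₂) (Y₁ := Y₁) (Y₂ := Y₂)) m =
      leftUnit p m ≫ X₁ ⊴ₗ leftUnit q (Y₁ ⊙ₗ m) ≫ X₁ ⊴ₗ X₂ ⊴ₗ (αₗ Y₂ Y₁ m).inv ≫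
        (αₗ X₁ X₂ _).inv := by
  simp [leftUnit, tensor_coevaluation_eq]

lemma leftCounit_tensor {X₁ X₂ Y₁ Y₂ : C} (p : ExactPairing X₁ Y₁) (q : ExactPairing X₂ Y₂)
    (m : M) :
    leftCounit (ExactPairing.tensor (X₁ := X₁) (X₂ := X₂) (Y₁ := Y₁) (Y₂ := Y₂)) m =
      (αₗ Y₂ Y₁ _).hom ≫ Y₂ ⊴ₗ Y₁ ⊴ₗ (αₗ X₁ X₂ m).hom ≫ Y₂ ⊴ₗ leftCounit p (X₂ ⊙ₗ m) ≫
        leftCounit q m := by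
  simp [leftCounit, tensor_evaluation_eq]

lemma leftUnit_unit (m : M) :
    leftUnit (exactPairingUnit (C := C)) m = (λₗ[C] m).inv ≫ (λₗ[C] _).inv := by
  have h : η_ (𝟙_ C) (𝟙_ C) = (ρ_ _).inv := rfl
  simp [leftUnit, h]

lemma leftCounit_unit (m : M) :
    leftCounit (exactPairingUnit (C := C)) m = (λₗ[C] _).hom ≫ (λₗ[C] m).hom := by
  have h : ε_ (𝟙_ C) (𝟙_ C) = (ρ_ _).hom := rfl
  simp [leftCounit, h]

/-- The morphism `x ⟶ Xᘁ.(Xᘁᘁ.x) ⟶ Xᘁ.(X.m) ⟶ m` attached to `f : Xᘁᘁ.x ⟶ X.m`. -/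
def RightDualTriple.transpose (P : RightDualTriple C) {x m : M}
    (f : P.ddual ⊙ₗ x ⟶ P.obj ⊙ₗ m) : x ⟶ m :=
  leftUnit P.pair' x ≫ P.dual ⊴ₗ f ≫ leftCounit P.pair m

namespace RightDualTriple

lemma transpose_comp (P : RightDualTriple C) {x m n : M} (f : P.ddual ⊙ₗ x ⟶ P.obj ⊙ₗ m)
    (g : m ⟶ n) : P.transpose (f ≫ P.obj ⊴ₗ g) = P.transpose f ≫ g := by
  simp [transpose, leftCounit_naturality]

/-- Transposition is dinatural in the acting object. -/
lemma transpose_mate (P Q : RightDualTriple C) (f : P.obj ⟶ Q.obj) {x m : M}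
    (g : Q.ddual ⊙ₗ x ⟶ P.obj ⊙ₗ m) :
    Q.transpose (g ≫ f ⊵ₗ m) = P.transpose (mate P Q f ⊵ₗ x ≫ g) := by
  simp only [transpose, actionHomRight_comp, Category.assoc, mate]
  rw [← leftCounit_rightMate P.pair Q.pair f m, ← reassoc_of% leftUnit_rightMate Q.pair' P.pair',
    action_exchange_assoc]

lemma transpose_tensor (P Q : RightDualTriple C) {x m : M}
    (f : (P.ddual ⊗ Q.ddual) ⊙ₗ x ⟶ (P.obj ⊗ Q.obj) ⊙ₗ m) :
    (P.tensor Q).transpose f =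
      Q.transpose (P.transpose ((αₗ P.ddual Q.ddual x).inv ≫ f ≫ (αₗ P.obj Q.obj m).hom)) := by
  have h := leftUnit_tensor Q.pair' P.pair' x
  have h' := leftCounit_tensor P.pair Q.pair m
  simp only [transpose, tensor, h, h']
  simp

lemma transpose_unit {x m : M} (f : (𝟙_ C) ⊙ₗ x ⟶ (𝟙_ C) ⊙ₗ m) :
    (unit C).transpose f = (λₗ[C] x).inv ≫ f ≫ (λₗ[C] m).hom := by
  simp [transpose, unit, leftUnit_unit, leftCounit_unit]

end RightDualTriple

end LeftAction

section RightAction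

open MonoidalRightAction

variable {C M : Type*} [Category* C] [MonoidalCategory C] [Category* M] [MonoidalRightAction C M]

lemma actionHomRight_associator_hom (c₁ c₂ c₃ : C) (m : M) :
    m ⊴ᵣ (α_ c₁ c₂ c₃).hom = (αᵣ m (c₁ ⊗ c₂) c₃).hom ≫ (αᵣ m c₁ c₂).hom ⊵ᵣ c₃ ≫
      (αᵣ (m ⊙ᵣ c₁) c₂ c₃).inv ≫ (αᵣ m c₁ (c₂ ⊗ c₃)).inv := by
  simp [← actionHom_associator_assoc]

lemma actionHomRight_associator_inv (c₁ c₂ c₃ : C) (m : M) :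
    m ⊴ᵣ (α_ c₁ c₂ c₃).inv = (αᵣ m c₁ (c₂ ⊗ c₃)).hom ≫ (αᵣ (m ⊙ᵣ c₁) c₂ c₃).hom ≫
      (αᵣ m c₁ c₂).inv ⊵ᵣ c₃ ≫ (αᵣ m (c₁ ⊗ c₂) c₃).inv := by
  rw [← cancel_epi (m ⊴ᵣ (α_ c₁ c₂ c₃).hom), actionHomRight_hom_inv]
  simp [actionHomRight_associator_hom]

lemma actionHomRight_leftUnitor_inv (c : C) (m : M) :
    m ⊴ᵣ (λ_ c).inv = (ρᵣ[C] m).inv ⊵ᵣ c ≫ (αᵣ m (𝟙_ C) c).inv := by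
  rw [← cancel_epi (m ⊴ᵣ (λ_ c).hom), actionHomRight_hom_inv]
  simp

lemma actionHomRight_rightUnitor_inv (c : C) (m : M) :
    m ⊴ᵣ (ρ_ c).inv = (ρᵣ[C] (m ⊙ᵣ c)).inv ≫ (αᵣ m c (𝟙_ C)).inv := by
  rw [← cancel_epi (m ⊴ᵣ (ρ_ c).hom), actionHomRight_hom_inv]
  simp

attribute [local simp] whiskerRight_actionHomLeft actionHomRight_associator_hom
  actionHomRight_associator_inv actionHomRight_leftUnitor_inv actionHomRight_rightUnitor_inv

-- This rewrites `(m ⊙ᵣ X) ⊴ᵣ f` in the direction opposite to `whiskerRight_actionHomLeft`.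
attribute [-simp] action_actionHomRight

/-- The unit `m ⟶ (m.X).X'` of the adjunction between the actions of `X` and `X'`. -/
def rightUnit {X X' : C} (p : ExactPairing X X') (m : M) : m ⟶ (m ⊙ᵣ X) ⊙ᵣ X' :=
  (ρᵣ[C] m).inv ≫ m ⊴ᵣ η_ X X' ≫ (αᵣ m X X').hom

/-- The counit `(m.X').X ⟶ m` of the adjunction between the actions of `X` and `X'`. -/
def rightCounit {X X' : C} (p : ExactPairing X X') (m : M) : (m ⊙ᵣ X') ⊙ᵣ X ⟶ m :=
  (αᵣ m X' X).inv ≫ m ⊴ᵣ ε_ X X' ≫ (ρᵣ[C] m).hom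

lemma rightUnit_naturality {X X' : C} (p : ExactPairing X X') {m n : M} (f : m ⟶ n) :
    rightUnit p m ≫ (f ⊵ᵣ X) ⊵ᵣ X' = f ≫ rightUnit p n := by
  have h := (action_exchange f (η_ X X')).symm
  simp only [actionHomLeft_tensor, unit_actionHomRight, Category.assoc] at h
  have h' := (ρᵣ[C] m).inv ≫= h.symm =≫ (αᵣ n X X').hom
  simpa [rightUnit] using h'

lemma rightCounit_naturality {X X' : C} (p : ExactPairing X X') {m n : M} (f : m ⟶ n) :
    (f ⊵ᵣ X') ⊵ᵣ X ≫ rightCounit p n = rightCounit p m ≫ f := by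
  have h := (αᵣ m X' X).inv ≫= action_exchange f (ε_ X X') =≫ (ρᵣ[C] n).hom
  simpa [rightCounit] using h.symm

lemma rightUnit_rightCounit {X X' : C} (p : ExactPairing X X') (m : M) :
    rightUnit p m ⊵ᵣ X ≫ rightCounit p (m ⊙ᵣ X) = 𝟙 _ := by
  have h := ((ρᵣ[C] m).inv ⊵ᵣ X ≫ (αᵣ m (𝟙_ C) X).inv) ≫=
    congrArg (fun t => m ⊴ᵣ t) (ExactPairing.evaluation_coevaluation X X') =≫
      ((αᵣ _ _ _).hom ≫ (ρᵣ[C] _).hom)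
  simpa [rightUnit, rightCounit, -ExactPairing.coevaluation_evaluation,
    -ExactPairing.evaluation_coevaluation] using h

lemma rightUnit_rightCounit' {X X' : C} (p : ExactPairing X X') (m : M) :
    rightUnit p (m ⊙ᵣ X') ≫ rightCounit p m ⊵ᵣ X' = 𝟙 _ := by
  have h := ((ρᵣ[C] _).inv ≫ (αᵣ m X' (𝟙_ C)).inv) ≫=
    congrArg (fun t => m ⊴ᵣ t) (ExactPairing.coevaluation_evaluation X X') =≫
      ((αᵣ _ _ _).hom ≫ (ρᵣ[C] m).hom ⊵ᵣ X')
  simpa [rightUnit, rightCounit, -ExactPairing.coevaluation_evaluation,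
    -ExactPairing.evaluation_coevaluation] using h

/-- An exact pairing of `X` and `X'` makes the right action of `X` left adjoint to that of
`X'`. -/
def rightAdjunction {X X' : C} (p : ExactPairing X X') :
    MonoidalRightAction.actionRight M X ⊣ MonoidalRightAction.actionRight M X' where
  unit := { app := rightUnit p, naturality _ _ f := (rightUnit_naturality p f).symm }
  counit := { app := rightCounit p, naturality _ _ f := rightCounit_naturality p f }
  left_triangle_components m := rightUnit_rightCounit p m
  right_triangle_components m := rightUnit_rightCounit' p m

lemma rightUnit_leftMate {X X' Y Y' : C} (p : ExactPairing X' X) (q : ExactPairing Y' Y)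
    (f : X ⟶ Y) (m : M) :
    rightUnit p m ≫ (m ⊙ᵣ X') ⊴ᵣ f = rightUnit q m ≫ (m ⊴ᵣ leftMate p q f) ⊵ᵣ Y := by
  have h : η_ Y' Y ≫ leftMate p q f ▷ Y = η_ X' X ≫ X' ◁ f :=
    @coevaluation_comp_leftAdjointMate C _ _ X Y (@HasLeftDual.mk _ _ _ X X' p)
      (@HasLeftDual.mk _ _ _ Y Y' q) f
  have h' := (ρᵣ[C] m).inv ≫= congrArg (fun t => m ⊴ᵣ t) h =≫ (αᵣ _ _ _).hom
  simpa [rightUnit] using h'.symm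

lemma rightCounit_leftMate {X X' Y Y' : C} (p : ExactPairing X' X) (q : ExactPairing Y' Y)
    (f : X ⟶ Y) (m : M) :
    (m ⊙ᵣ X) ⊴ᵣ leftMate p q f ≫ rightCounit p m = (m ⊴ᵣ f) ⊵ᵣ Y' ≫ rightCounit q m := by
  have h := (αᵣ _ _ _).inv ≫= congrArg (fun t => m ⊴ᵣ t) (leftMate_evaluation p q f) =≫
    (ρᵣ[C] m).hom
  simpa [rightCounit] using h

lemma rightUnit_tensor {X₁ X₂ Y₁ Y₂ : C} (p : ExactPairing X₁ Y₁) (q : ExactPairing X₂ Y₂)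
    (m : M) :
    rightUnit (ExactPairing.tensor (X₁ := X₁) (X₂ := X₂) (Y₁ := Y₁) (Y₂ := Y₂)) m =
      rightUnit p m ≫ rightUnit q (m ⊙ᵣ X₁) ⊵ᵣ Y₁ ≫ ((αᵣ m X₁ X₂).inv ⊵ᵣ Y₂) ⊵ᵣ Y₁ ≫
        (αᵣ _ Y₂ Y₁).inv := by
  simp [rightUnit, tensor_coevaluation_eq]

lemma rightCounit_tensor {X₁ X₂ Y₁ Y₂ : C} (p : ExactPairing X₁ Y₁) (q : ExactPairing X₂ Y₂)
    (m : M) :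
    rightCounit (ExactPairing.tensor (X₁ := X₁) (X₂ := X₂) (Y₁ := Y₁) (Y₂ := Y₂)) m =
      (αᵣ _ X₁ X₂).hom ≫ ((αᵣ m Y₂ Y₁).hom ⊵ᵣ X₁) ⊵ᵣ X₂ ≫ rightCounit p (m ⊙ᵣ Y₂) ⊵ᵣ X₂ ≫
        rightCounit q m := by
  simp [rightCounit, tensor_evaluation_eq]

lemma rightUnit_unit (m : M) :
    rightUnit (exactPairingUnit (C := C)) m = (ρᵣ[C] m).inv ≫ (ρᵣ[C] _).inv := by
  have h : η_ (𝟙_ C) (𝟙_ C) = (ρ_ _).inv := rfl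
  simp [rightUnit, h]

lemma rightCounit_unit (m : M) :
    rightCounit (exactPairingUnit (C := C)) m = (ρᵣ[C] _).hom ≫ (ρᵣ[C] m).hom := by
  have h : ε_ (𝟙_ C) (𝟙_ C) = (ρ_ _).hom := rfl
  simp [rightCounit, h]

/-- The morphism `x ⟶ (x.ᘁᘁX).ᘁX ⟶ (m.X).ᘁX ⟶ m` attached to `f : x.ᘁᘁX ⟶ m.X`. -/
def LeftDualTriple.transpose (P : LeftDualTriple C) {x m : M}
    (f : x ⊙ᵣ P.ddual ⟶ m ⊙ᵣ P.obj) : x ⟶ m :=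
  rightUnit P.pair' x ≫ f ⊵ᵣ P.dual ≫ rightCounit P.pair m

namespace LeftDualTriple

lemma transpose_comp (P : LeftDualTriple C) {x m n : M} (f : x ⊙ᵣ P.ddual ⟶ m ⊙ᵣ P.obj)
    (g : m ⟶ n) : P.transpose (f ≫ g ⊵ᵣ P.obj) = P.transpose f ≫ g := by
  simp [transpose, rightCounit_naturality]

/-- Transposition is dinatural in the acting object. -/
lemma transpose_mate (P Q : LeftDualTriple C) (f : P.obj ⟶ Q.obj) {x m : M}
    (g : x ⊙ᵣ Q.ddual ⟶ m ⊙ᵣ P.obj) :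
    Q.transpose (g ≫ m ⊴ᵣ f) = P.transpose (x ⊴ᵣ mate P Q f ≫ g) := by
  simp only [transpose, comp_actionHomLeft, Category.assoc, mate]
  rw [← rightCounit_leftMate P.pair Q.pair f m, ← reassoc_of% rightUnit_leftMate Q.pair' P.pair',
    ← action_exchange_assoc]

lemma transpose_tensor (P Q : LeftDualTriple C) {x m : M}
    (f : x ⊙ᵣ (P.ddual ⊗ Q.ddual) ⟶ m ⊙ᵣ (P.obj ⊗ Q.obj)) :
    (P.tensor Q).transpose f =
      P.transpose (Q.transpose ((αᵣ x P.ddual Q.ddual).inv ≫ f ≫ (αᵣ m P.obj Q.obj).hom)) := by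
  have h := rightUnit_tensor P.pair' Q.pair' x
  have h' := rightCounit_tensor Q.pair P.pair m
  simp only [transpose, tensor, h, h']
  simp

lemma transpose_unit {x m : M} (f : x ⊙ᵣ (𝟙_ C) ⟶ m ⊙ᵣ (𝟙_ C)) :
    (unit C).transpose f = (ρᵣ[C] x).inv ≫ f ≫ (ρᵣ[C] m).hom := by
  simp [transpose, unit, rightUnit_unit, rightCounit_unit]

end LeftDualTriple

end RightAction


/-! ### Transposes in bimodule categories -/

section Mid

open BimoduleCategory

variable {A B M : Type*} [Category* A] [MonoidalCategory A] [Category* B] [MonoidalCategory B]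
  [Category* M] [MonoidalLeftAction A M] [MonoidalRightAction B M] [BimoduleCategory A B M]

lemma mid_naturality_middle (a : A) {m n : M} (g : m ⟶ n) (b : B) :
    (a ⊴ₗ g) ⊵ᵣ b ≫ (mid a n b).hom = (mid a m b).hom ≫ a ⊴ₗ (g ⊵ᵣ b) := by
  simpa only [MonoidalRightAction.actionHom_id, MonoidalLeftAction.id_actionHom]
    using mid_naturality (𝟙 a) g (𝟙 b)

lemma mid_naturality_left {a a' : A} (f : a ⟶ a') (m : M) (b : B) :
    (f ⊵ₗ m) ⊵ᵣ b ≫ (mid a' m b).hom = (mid a m b).hom ≫ f ⊵ₗ (m ⊙ᵣ b) := by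
  simpa only [MonoidalRightAction.actionHom_id, MonoidalRightAction.id_actionHomLeft,
    MonoidalLeftAction.actionHom_id] using mid_naturality f (𝟙 m) (𝟙 b)

lemma mid_naturality_right (a : A) (m : M) {b b' : B} (h : b ⟶ b') :
    (a ⊙ₗ m) ⊴ᵣ h ≫ (mid a m b').hom = (mid a m b).hom ≫ a ⊴ₗ (m ⊴ᵣ h) := by
  simpa only [MonoidalRightAction.id_actionHom, MonoidalLeftAction.id_actionHom,
    MonoidalLeftAction.actionHomRight_id] using mid_naturality (𝟙 a) (𝟙 m) h

/-- As in a monoidal category, the unit triangle follows from the pentagon. -/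
lemma mid_leftUnitor (m : M) (b : B) :
    (mid (𝟙_ A) m b).hom ≫ (λₗ[A] (m ⊙ᵣ b)).hom = (λₗ[A] m).hom ⊵ᵣ b := by
  have faithful {x y : M} {f g : x ⟶ y} (h : (𝟙_ A) ⊴ₗ f = (𝟙_ A) ⊴ₗ g) : f = g := by
    rw [← cancel_epi (λₗ[A] x).hom, MonoidalLeftAction.actionUnitIso_hom_naturality, h,
      MonoidalLeftAction.actionUnitIso_hom_naturality]
  apply faithful
  have h := mid_left (𝟙_ A) (𝟙_ A) m b =≫ (𝟙_ A) ⊴ₗ (λₗ[A] (m ⊙ᵣ b)).hom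
  rw [Category.assoc, Category.assoc, Category.assoc, ← MonoidalLeftAction.rightUnitor_actionHom,
    ← mid_naturality_left, MonoidalLeftAction.rightUnitor_actionHom,
    MonoidalRightAction.comp_actionHomLeft, Category.assoc,
    mid_naturality_middle, cancel_epi, cancel_epi] at h
  rw [MonoidalLeftAction.actionHomRight_comp, h]

lemma mid_rightUnitor (a : A) (m : M) :
    (mid a m (𝟙_ B)).hom ≫ a ⊴ₗ (ρᵣ[B] m).hom = (ρᵣ[B] (a ⊙ₗ m)).hom := by
  have faithful {x y : M} {f g : x ⟶ y} (h : f ⊵ᵣ (𝟙_ B) = g ⊵ᵣ (𝟙_ B)) : f = g := by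
    rw [← cancel_epi (ρᵣ[B] x).hom, MonoidalRightAction.actionUnitIso_hom_naturality, h,
      MonoidalRightAction.actionUnitIso_hom_naturality]
  apply faithful
  have h := mid_right a m (𝟙_ B) (𝟙_ B) =≫ a ⊴ₗ ((ρᵣ[B] m).hom ⊵ᵣ (𝟙_ B))
  rw [Category.assoc, Category.assoc, Category.assoc, ← MonoidalLeftAction.actionHomRight_comp,
    ← MonoidalRightAction.actionHom_leftUnitor, ← mid_naturality_right, ← mid_naturality_middle,
    MonoidalRightAction.actionHom_leftUnitor, Category.assoc, cancel_epi, ← Category.assoc,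
    cancel_mono] at h
  rw [MonoidalRightAction.comp_actionHomLeft, h]

lemma leftUnit_mid {X X' : A} (p : ExactPairing X X') (m : M) (b : B) :
    leftUnit p m ⊵ᵣ b ≫ (mid X (X' ⊙ₗ m) b).hom ≫ X ⊴ₗ (mid X' m b).hom =
      leftUnit p (m ⊙ᵣ b) := by
  have h : (λₗ[A] m).inv ⊵ᵣ b ≫ (mid (𝟙_ A) m b).hom = (λₗ[A] (m ⊙ᵣ b)).inv := by
    rw [← cancel_mono (λₗ[A] (m ⊙ᵣ b)).hom, Category.assoc, mid_leftUnitor]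
    simp
  simp only [leftUnit, MonoidalRightAction.comp_actionHomLeft, Category.assoc, mid_left,
    reassoc_of% mid_naturality_left, reassoc_of% h]

lemma leftCounit_mid {X X' : A} (p : ExactPairing X X') (m : M) (b : B) :
    (mid X' (X ⊙ₗ m) b).hom ≫ X' ⊴ₗ (mid X m b).hom ≫ leftCounit p (m ⊙ᵣ b) =
      leftCounit p m ⊵ᵣ b := by
  have h := (αₗ X' X m).inv ⊵ᵣ b ≫= mid_left X' X m b =≫ (αₗ X' X (m ⊙ᵣ b)).inv
  simp only [Category.assoc, Iso.hom_inv_id, Category.comp_id,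
    MonoidalRightAction.inv_hom_actionHomLeft_assoc] at h
  simp only [leftCounit, MonoidalRightAction.comp_actionHomLeft, ← mid_leftUnitor,
    reassoc_of% mid_naturality_left, ← reassoc_of% h]

lemma rightUnit_mid {Y Y' : B} (p : ExactPairing Y Y') (a : A) (m : M) :
    rightUnit p (a ⊙ₗ m) ≫ (mid a m Y).hom ⊵ᵣ Y' ≫ (mid a (m ⊙ᵣ Y) Y').hom =
      a ⊴ₗ rightUnit p m := by
  have h : (ρᵣ[B] (a ⊙ₗ m)).inv ≫ (mid a m (𝟙_ B)).hom = a ⊴ₗ (ρᵣ[B] m).inv := by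
    rw [← cancel_mono (a ⊴ₗ (ρᵣ[B] m).hom), Category.assoc, mid_rightUnitor]
    simp
  simp only [rightUnit, MonoidalLeftAction.actionHomRight_comp, Category.assoc, mid_right,
    reassoc_of% mid_naturality_right, reassoc_of% h]

lemma rightCounit_mid {Y Y' : B} (p : ExactPairing Y Y') (a : A) (m : M) :
    (mid a m Y').hom ⊵ᵣ Y ≫ (mid a (m ⊙ᵣ Y') Y).hom ≫ a ⊴ₗ rightCounit p m =
      rightCounit p (a ⊙ₗ m) := by
  have h := (αᵣ (a ⊙ₗ m) Y' Y).inv ≫= mid_right a m Y' Y =≫ a ⊴ₗ (αᵣ m Y' Y).inv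
  simp only [Category.assoc, Iso.inv_hom_id_assoc, Category.comp_id,
    MonoidalLeftAction.actionHomRight_hom_inv] at h
  simp only [rightCounit, MonoidalLeftAction.actionHomRight_comp, ← mid_rightUnitor,
    reassoc_of% mid_naturality_right, ← reassoc_of% h]

/-- The transposition for the left action commutes with that for the right action. -/
lemma transpose_mid (P : RightDualTriple A) (Q : LeftDualTriple B) {x m : M}
    (g : P.ddual ⊙ₗ (x ⊙ᵣ Q.ddual) ⟶ (P.obj ⊙ₗ m) ⊙ᵣ Q.obj) :
    Q.transpose (P.transpose (g ≫ (mid P.obj m Q.obj).hom)) =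
      P.transpose (Q.transpose ((mid P.ddual x Q.ddual).hom ≫ g)) := by
  have hu : rightUnit Q.pair' (P.dual ⊙ₗ (P.ddual ⊙ₗ x)) ≫
      (mid P.dual (P.ddual ⊙ₗ x) Q.ddual).hom ⊵ᵣ Q.dual =
        P.dual ⊴ₗ rightUnit Q.pair' (P.ddual ⊙ₗ x) ≫
          (mid P.dual ((P.ddual ⊙ₗ x) ⊙ᵣ Q.ddual) Q.dual).inv := by
    rw [← cancel_mono (mid P.dual ((P.ddual ⊙ₗ x) ⊙ᵣ Q.ddual) Q.dual).hom, Category.assoc,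
      rightUnit_mid, Category.assoc, Iso.inv_hom_id, Category.comp_id]
  have hc : P.dual ⊴ₗ (mid P.obj m Q.obj).hom ≫ leftCounit P.pair (m ⊙ᵣ Q.obj) =
      (mid P.dual (P.obj ⊙ₗ m) Q.obj).inv ≫ leftCounit P.pair m ⊵ᵣ Q.obj := by
    rw [← leftCounit_mid, Iso.inv_hom_id_assoc]
  have hn {y z : M} (f : y ⟶ z) : (mid P.dual y Q.dual).inv ≫ (P.dual ⊴ₗ f) ⊵ᵣ Q.dual =
      P.dual ⊴ₗ (f ⊵ᵣ Q.dual) ≫ (mid P.dual z Q.dual).inv := by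
    rw [Iso.inv_comp_eq, ← reassoc_of% mid_naturality_middle, Iso.hom_inv_id, Category.comp_id]
  have hc' : (mid P.dual ((P.obj ⊙ₗ m) ⊙ᵣ Q.obj) Q.dual).inv ≫
      (mid P.dual (P.obj ⊙ₗ m) Q.obj).inv ⊵ᵣ Q.dual ≫
        rightCounit Q.pair (P.dual ⊙ₗ (P.obj ⊙ₗ m)) =
      P.dual ⊴ₗ rightCounit Q.pair (P.obj ⊙ₗ m) := by
    rw [← rightCounit_mid, MonoidalRightAction.inv_hom_actionHomLeft_assoc,
      Iso.inv_hom_id_assoc]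
  simp only [RightDualTriple.transpose, LeftDualTriple.transpose,
    MonoidalLeftAction.actionHomRight_comp, MonoidalRightAction.comp_actionHomLeft,
    Category.assoc, hc, ← leftUnit_mid]
  rw [reassoc_of% rightUnit_naturality, rightCounit_naturality, reassoc_of% hu, reassoc_of% hn,
    reassoc_of% hn, reassoc_of% hc']

end Mid


/-! ### Module functor structures from natural isomorphisms -/

section OfIso

variable {D D' : Type*} [Category* D] [Category* D'] (F : D ⥤ D') (C : Type*) [Category* C]
  [MonoidalCategory C]

/-- A left module functor structure given by its oplax constraints, which are isomorphisms. -/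
@[reducible]
def leftLinearOfIso [MonoidalLeftAction C D] [MonoidalLeftAction C D']
    (φ : ∀ (c : C) (d : D), F.obj (c ⊙ₗ d) ≅ c ⊙ₗ F.obj d)
    (naturality_left : ∀ {c c' : C} (f : c ⟶ c') (d : D),
      F.map (f ⊵ₗ d) ≫ (φ c' d).hom = (φ c d).hom ≫ f ⊵ₗ F.obj d)
    (naturality_right : ∀ (c : C) {d d' : D} (f : d ⟶ d'),
      F.map (c ⊴ₗ f) ≫ (φ c d').hom = (φ c d).hom ≫ c ⊴ₗ F.map f)
    (associativity : ∀ (c c' : C) (d : D), (φ (c ⊗ c') d).hom ≫ (αₗ c c' (F.obj d)).hom =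
      F.map (αₗ c c' d).hom ≫ (φ c (c' ⊙ₗ d)).hom ≫ c ⊴ₗ (φ c' d).hom)
    (unitality : ∀ d : D, (φ (𝟙_ C) d).hom ≫ (λₗ[C] (F.obj d)).hom = F.map (λₗ[C] d).hom) :
    F.LeftLinear C where
  μₗ c d := (φ c d).inv
  δₗ c d := (φ c d).hom
  μₗ_naturality_left f d := by
    rw [Iso.eq_inv_comp, ← Category.assoc, Iso.comp_inv_eq, naturality_left]
  μₗ_naturality_right c _ _ f := by
    rw [Iso.eq_inv_comp, ← Category.assoc, Iso.comp_inv_eq, naturality_right]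
  μₗ_associativity c c' d := by
    have h : F.map (αₗ c c' d).hom = (φ (c ⊗ c') d).hom ≫ (αₗ c c' (F.obj d)).hom ≫
        c ⊴ₗ (φ c' d).inv ≫ (φ c (c' ⊙ₗ d)).inv := by
      rw [reassoc_of% associativity]
      simp
    rw [Iso.inv_comp_eq, h]
  μₗ_unitality d := by rw [Iso.eq_inv_comp, unitality]
  δₗ_naturality_left f d := naturality_left f d
  δₗ_naturality_right c _ _ f := naturality_right c f
  δₗ_associativity c c' d := associativity c c' d
  δₗ_unitality_inv d := by
    rw [← cancel_mono (λₗ[C] (F.obj d)).hom, Category.assoc, unitality]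
    simp [← F.map_comp]
  μₗ_comp_δₗ c d := (φ c d).inv_hom_id
  δₗ_comp_μₗ c d := (φ c d).hom_inv_id

/-- A right module functor structure given by its oplax constraints, which are isomorphisms. -/
@[reducible]
def rightLinearOfIso [MonoidalRightAction C D] [MonoidalRightAction C D']
    (φ : ∀ (d : D) (c : C), F.obj (d ⊙ᵣ c) ≅ F.obj d ⊙ᵣ c)
    (naturality_right : ∀ (d : D) {c c' : C} (f : c ⟶ c'),
      F.map (d ⊴ᵣ f) ≫ (φ d c').hom = (φ d c).hom ≫ F.obj d ⊴ᵣ f)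
    (naturality_left : ∀ {d d' : D} (f : d ⟶ d') (c : C),
      F.map (f ⊵ᵣ c) ≫ (φ d' c).hom = (φ d c).hom ≫ F.map f ⊵ᵣ c)
    (associativity : ∀ (d : D) (c c' : C), (φ d (c ⊗ c')).hom ≫ (αᵣ (F.obj d) c c').hom =
      F.map (αᵣ d c c').hom ≫ (φ (d ⊙ᵣ c) c').hom ≫ (φ d c).hom ⊵ᵣ c')
    (unitality : ∀ d : D, (φ d (𝟙_ C)).hom ≫ (ρᵣ[C] (F.obj d)).hom = F.map (ρᵣ[C] d).hom) :
    F.RightLinear C where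
  μᵣ d c := (φ d c).inv
  δᵣ d c := (φ d c).hom
  μᵣ_naturality_right d _ _ f := by
    rw [Iso.eq_inv_comp, ← Category.assoc, Iso.comp_inv_eq, naturality_right]
  μᵣ_naturality_left f c := by
    rw [Iso.eq_inv_comp, ← Category.assoc, Iso.comp_inv_eq, naturality_left]
  μᵣ_associativity d c c' := by
    have h : F.map (αᵣ d c c').hom = (φ d (c ⊗ c')).hom ≫ (αᵣ (F.obj d) c c').hom ≫
        (φ d c).inv ⊵ᵣ c' ≫ (φ (d ⊙ᵣ c) c').inv := by
      rw [reassoc_of% associativity]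
      simp
    rw [Iso.inv_comp_eq, h]
  μᵣ_unitality d := by rw [Iso.eq_inv_comp, unitality]
  δᵣ_naturality_right d _ _ f := naturality_right d f
  δᵣ_naturality_left f c := naturality_left f c
  δᵣ_associativity d c c' := associativity d c c'
  δᵣ_unitality_inv d := by
    rw [← cancel_mono (ρᵣ[C] (F.obj d)).hom, Category.assoc, unitality]
    simp [← F.map_comp]
  μᵣ_comp_δᵣ d c := (φ d c).inv_hom_id
  δᵣ_comp_μᵣ d c := (φ d c).hom_inv_id

end OfIso

/-! ### Joint monicity of the images of the components under the actions -/

section JointlyMonic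

universe w v u

variable {k : Type w} [Field k] {A B : Type*} [Category* A] [MonoidalCategory A]
  [RightRigidCategory A] [Category* B] [MonoidalCategory B] [LeftRigidCategory B] {M : Type u}
  [Category.{v} M] [Preadditive M] [Linear k M] [HasFiniteBiproducts M] [IsFiniteLinear k M]
  [MonoidalLeftAction A M] [MonoidalRightAction B M]

namespace NakayamaEnds

variable (E : NakayamaEnds k M)

lemma hom_ext_actionLeft (c : A) {m z : M} {f g : z ⟶ c ⊙ₗ E.functor.obj m}
    (h : ∀ x ξ, f ≫ c ⊴ₗ E.component m x ξ = g ≫ c ⊴ₗ E.component m x ξ) : f = g :=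
  E.hom_ext_map_component (leftAdjunction (RightDualTriple.of c).pair) h

lemma hom_ext_actionLeft_actionLeft (c d : A) {m z : M} {f g : z ⟶ c ⊙ₗ d ⊙ₗ E.functor.obj m}
    (h : ∀ x ξ, f ≫ c ⊴ₗ d ⊴ₗ E.component m x ξ = g ≫ c ⊴ₗ d ⊴ₗ E.component m x ξ) : f = g :=
  E.hom_ext_map_component ((leftAdjunction (RightDualTriple.of c).pair).comp
    (leftAdjunction (RightDualTriple.of d).pair)) h

lemma hom_ext_actionRight (c : B) {m z : M} {f g : z ⟶ E.functor.obj m ⊙ᵣ c}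
    (h : ∀ x ξ, f ≫ E.component m x ξ ⊵ᵣ c = g ≫ E.component m x ξ ⊵ᵣ c) : f = g :=
  E.hom_ext_map_component (rightAdjunction (LeftDualTriple.of c).pair) h

lemma hom_ext_actionRight_actionRight (c d : B) {m z : M}
    {f g : z ⟶ (E.functor.obj m ⊙ᵣ c) ⊙ᵣ d}
    (h : ∀ x ξ, f ≫ (E.component m x ξ ⊵ᵣ c) ⊵ᵣ d = g ≫ (E.component m x ξ ⊵ᵣ c) ⊵ᵣ d) :
    f = g :=
  E.hom_ext_map_component ((rightAdjunction (LeftDualTriple.of d).pair).comp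
    (rightAdjunction (LeftDualTriple.of c).pair)) h

lemma hom_ext_actionRight_actionLeft (c : A) (d : B) {m z : M}
    {f g : z ⟶ c ⊙ₗ (E.functor.obj m ⊙ᵣ d)}
    (h : ∀ x ξ, f ≫ c ⊴ₗ (E.component m x ξ ⊵ᵣ d) = g ≫ c ⊴ₗ (E.component m x ξ ⊵ᵣ d)) :
    f = g :=
  E.hom_ext_map_component ((leftAdjunction (RightDualTriple.of c).pair).comp
    (rightAdjunction (LeftDualTriple.of d).pair)) h

end NakayamaEnds

end JointlyMonic

/-! ### The left module functor structure -/

section LeftStructure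

universe w v u

variable {k : Type w} [Field k] {A : Type*} [Category* A] [Preadditive A] [Linear k A]
  [MonoidalCategory A] {M : Type u} [Category.{v} M] [Preadditive M] [Linear k M]
  [MonoidalLeftAction A M] [IsLinearLeftModule k A M]

variable (k) in
/-- Transposition `Hom(Xᘁᘁ.x, X.m) → Hom(x, m)` as a linear map. -/
def RightDualTriple.transposeLinear (P : RightDualTriple A) (x m : M) :
    (P.ddual ⊙ₗ x ⟶ P.obj ⊙ₗ m) →ₗ[k] (x ⟶ m) :=
  haveI := IsLinearLeftModule.additive_left (k := k) (M := M) P.dual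
  haveI := IsLinearLeftModule.linear_left (k := k) (M := M) P.dual
  adjTranspose k (leftAdjunction P.pair) (leftAdjunction P.pair') x m

lemma leftTranspose_eq [RightRigidCategory A] (a : A) (x m : M) :
    leftTranspose k a x m = (RightDualTriple.of a).transposeLinear k x m := by
  refine LinearMap.ext fun f => ?_
  change leftTranspose k a x m f = (RightDualTriple.of a).transpose f
  simp only [leftTranspose, RightDualTriple.transpose,
    leftUnit, leftCounit, Category.assoc]
  rfl

namespace NakayamaEnds

variable [RightRigidCategory A] [HasFiniteBiproducts M] [IsFiniteLinear k M]
  (E : NakayamaEnds k M)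

/-- The isomorphism `N(X.m) ≅ Xᘁᘁ.N(m)`, for an arbitrary choice of `Xᘁ` and `Xᘁᘁ`. -/
noncomputable def leftComparisonIso (P : RightDualTriple A) (m : M) :
    E.functor.obj (P.obj ⊙ₗ m) ≅ P.ddual ⊙ₗ E.functor.obj m :=
  haveI (c : A) := IsLinearLeftModule.additive_left (k := k) (M := M) c
  haveI (c : A) := IsLinearLeftModule.linear_left (k := k) (M := M) c
  E.comparisonIso (leftAdjunction P.pair) (leftAdjunction P.pair')
    (leftAdjunction (RightDualTriple.of P.ddual).pair) m

lemma leftComparisonIso_hom_component (P : RightDualTriple A) (m x : M)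
    (ξ : Module.Dual k (x ⟶ m)) :
    (E.leftComparisonIso P m).hom ≫ P.ddual ⊴ₗ E.component m x ξ =
      E.component (P.obj ⊙ₗ m) (P.ddual ⊙ₗ x) (ξ.comp (P.transposeLinear k x m)) :=
  have (c : A) := IsLinearLeftModule.additive_left (k := k) (M := M) c
  have (c : A) := IsLinearLeftModule.linear_left (k := k) (M := M) c
  E.comparisonIso_hom_map_component _ _ _ m x ξ

lemma leftComparisonIso_naturality_left (P Q : RightDualTriple A) (f : P.obj ⟶ Q.obj) (m : M) :
    E.functor.map (f ⊵ₗ m) ≫ (E.leftComparisonIso Q m).hom =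
      (E.leftComparisonIso P m).hom ≫ RightDualTriple.mate P Q f ⊵ₗ E.functor.obj m :=
  E.hom_ext_actionLeft _ fun x ξ => by
    rw [Category.assoc, Category.assoc, leftComparisonIso_hom_component, map_component,
      ← MonoidalLeftAction.action_exchange, reassoc_of% leftComparisonIso_hom_component,
      component_naturality]
    exact congrArg _ (LinearMap.ext fun g => congrArg ξ (RightDualTriple.transpose_mate P Q f g))

lemma leftComparisonIso_naturality_right (P : RightDualTriple A) {m m' : M} (f : m ⟶ m') :
    E.functor.map (P.obj ⊴ₗ f) ≫ (E.leftComparisonIso P m').hom =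
      (E.leftComparisonIso P m).hom ≫ P.ddual ⊴ₗ E.functor.map f :=
  E.hom_ext_actionLeft _ fun x ξ => by
    rw [Category.assoc, Category.assoc, leftComparisonIso_hom_component, map_component,
      ← MonoidalLeftAction.actionHomRight_comp, map_component, leftComparisonIso_hom_component]
    exact congrArg _ (LinearMap.ext fun g => congrArg ξ (P.transpose_comp g f))

lemma leftComparisonIso_unit (m : M) :
    (E.leftComparisonIso (RightDualTriple.unit A) m).hom ≫ (λₗ[A] (E.functor.obj m)).hom =
      E.functor.map (λₗ[A] m).hom :=
  E.hom_ext_component fun x ξ => by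
    rw [Category.assoc, MonoidalLeftAction.actionUnitIso_hom_naturality,
      reassoc_of% leftComparisonIso_hom_component, map_component, component_naturality]
    refine congrArg _ (LinearMap.ext fun g => congrArg ξ ?_)
    exact (RightDualTriple.transpose_unit ((λₗ[A] x).hom ≫ g)).trans (by simp)

/-- Coherence for the chosen duals `(X ⊗ Y)ᘁ = Yᘁ ⊗ Xᘁ`; other choices follow by naturality. -/
lemma leftComparisonIso_tensor (P Q : RightDualTriple A) (m : M) :
    (E.leftComparisonIso (P.tensor Q) m).hom ≫ (αₗ P.ddual Q.ddual (E.functor.obj m)).hom =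
      E.functor.map (αₗ P.obj Q.obj m).hom ≫ (E.leftComparisonIso P (Q.obj ⊙ₗ m)).hom ≫
        P.ddual ⊴ₗ (E.leftComparisonIso Q m).hom :=
  E.hom_ext_actionLeft_actionLeft _ _ fun x ξ => by
    have h : (αₗ P.ddual Q.ddual (E.functor.obj m)).hom ≫
        P.ddual ⊴ₗ Q.ddual ⊴ₗ E.component m x ξ =
          (P.ddual ⊗ Q.ddual) ⊴ₗ E.component m x ξ ≫ (αₗ P.ddual Q.ddual x).hom := by
      simp [MonoidalLeftAction.tensor_actionHomRight]
    simp only [Category.assoc]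
    rw [h, reassoc_of% leftComparisonIso_hom_component,
      ← MonoidalLeftAction.actionHomRight_comp, leftComparisonIso_hom_component,
      leftComparisonIso_hom_component, map_component, component_naturality]
    refine congrArg _ (LinearMap.ext fun g => congrArg ξ ?_)
    refine (RightDualTriple.transpose_tensor P Q ((αₗ P.ddual Q.ddual x).hom ≫ g)).trans ?_
    rw [Category.assoc, Iso.inv_hom_id_assoc]
    rfl

/-- The structure of a module functor `N : M ⥤ ᘁᘁM` on the Nakayama functor. -/
@[reducible]
noncomputable def leftLinear (B : Type*) [Category* B] [MonoidalCategory B] :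
    (E.functor ⋙ toTwist A B M).LeftLinear A :=
  leftLinearOfIso (E.functor ⋙ toTwist A B M) A
    (fun a m => E.leftComparisonIso (RightDualTriple.of a) m)
    (fun {a a'} f m => E.leftComparisonIso_naturality_left (RightDualTriple.of a)
      (RightDualTriple.of a') f m)
    (fun a _ _ f => E.leftComparisonIso_naturality_right (RightDualTriple.of a) f)
    (fun a b m => by
      -- The associator of the twisted action contains the constraint `(a ⊗ b)ᘁᘁ ≅ aᘁᘁ ⊗ bᘁᘁ`,
      -- which is the mate of the identity of `a ⊗ b` for the two choices of duals.
      have h := E.leftComparisonIso_naturality_left (RightDualTriple.of (a ⊗ b))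
        ((RightDualTriple.of a).tensor (RightDualTriple.of b)) (𝟙 _) m
      rw [MonoidalLeftAction.id_actionHomLeft, CategoryTheory.Functor.map_id,
        Category.id_comp] at h
      exact ((Category.assoc _ _ _).symm.trans (congrArg (· ≫ _) h.symm)).trans
        (E.leftComparisonIso_tensor (RightDualTriple.of a) (RightDualTriple.of b) m))
    (fun m => by
      have h := E.leftComparisonIso_naturality_left (RightDualTriple.of (𝟙_ A))
        (RightDualTriple.unit A) (𝟙 _) m
      rw [MonoidalLeftAction.id_actionHomLeft, CategoryTheory.Functor.map_id,
        Category.id_comp] at h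
      exact ((Category.assoc _ _ _).symm.trans (congrArg (· ≫ _) h.symm)).trans
        (E.leftComparisonIso_unit m))

end NakayamaEnds

end LeftStructure

/-! ### The right module functor structure -/

section RightStructure

universe w v u

variable {k : Type w} [Field k] {B : Type*} [Category* B] [Preadditive B] [Linear k B]
  [MonoidalCategory B] {M : Type u} [Category.{v} M] [Preadditive M] [Linear k M]
  [MonoidalRightAction B M] [IsLinearRightModule k B M]

variable (k) in
/-- Transposition `Hom(x.ᘁᘁX, m.X) → Hom(x, m)` as a linear map. -/
def LeftDualTriple.transposeLinear (P : LeftDualTriple B) (x m : M) :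
    (x ⊙ᵣ P.ddual ⟶ m ⊙ᵣ P.obj) →ₗ[k] (x ⟶ m) :=
  haveI := IsLinearRightModule.additive_right (k := k) (M := M) P.dual
  haveI := IsLinearRightModule.linear_right (k := k) (M := M) P.dual
  adjTranspose k (rightAdjunction P.pair) (rightAdjunction P.pair') x m

lemma rightTranspose_eq [LeftRigidCategory B] (x m : M) (b : B) :
    rightTranspose k x m b = (LeftDualTriple.of b).transposeLinear k x m := by
  refine LinearMap.ext fun f => ?_
  change rightTranspose k x m b f = (LeftDualTriple.of b).transpose f
  simp only [rightTranspose, LeftDualTriple.transpose,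
    rightUnit, rightCounit, Category.assoc]
  rfl

namespace NakayamaEnds

variable [LeftRigidCategory B] [HasFiniteBiproducts M] [IsFiniteLinear k M]
  (E : NakayamaEnds k M)

/-- The isomorphism `N(m.X) ≅ N(m).ᘁᘁX`, for an arbitrary choice of `ᘁX` and `ᘁᘁX`. -/
noncomputable def rightComparisonIso (m : M) (P : LeftDualTriple B) :
    E.functor.obj (m ⊙ᵣ P.obj) ≅ E.functor.obj m ⊙ᵣ P.ddual :=
  haveI (c : B) := IsLinearRightModule.additive_right (k := k) (M := M) c
  haveI (c : B) := IsLinearRightModule.linear_right (k := k) (M := M) c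
  E.comparisonIso (rightAdjunction P.pair) (rightAdjunction P.pair')
    (rightAdjunction (LeftDualTriple.of P.ddual).pair) m

lemma rightComparisonIso_hom_component (P : LeftDualTriple B) (m x : M)
    (ξ : Module.Dual k (x ⟶ m)) :
    (E.rightComparisonIso m P).hom ≫ E.component m x ξ ⊵ᵣ P.ddual =
      E.component (m ⊙ᵣ P.obj) (x ⊙ᵣ P.ddual) (ξ.comp (P.transposeLinear k x m)) :=
  have (c : B) := IsLinearRightModule.additive_right (k := k) (M := M) c
  have (c : B) := IsLinearRightModule.linear_right (k := k) (M := M) c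
  E.comparisonIso_hom_map_component _ _ _ m x ξ

lemma rightComparisonIso_naturality_right (m : M) (P Q : LeftDualTriple B) (f : P.obj ⟶ Q.obj) :
    E.functor.map (m ⊴ᵣ f) ≫ (E.rightComparisonIso m Q).hom =
      (E.rightComparisonIso m P).hom ≫ E.functor.obj m ⊴ᵣ LeftDualTriple.mate P Q f :=
  E.hom_ext_actionRight _ fun x ξ => by
    rw [Category.assoc, Category.assoc, rightComparisonIso_hom_component, map_component,
      MonoidalRightAction.action_exchange, reassoc_of% rightComparisonIso_hom_component,
      component_naturality]
    exact congrArg _ (LinearMap.ext fun g => congrArg ξ (LeftDualTriple.transpose_mate P Q f g))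

lemma rightComparisonIso_naturality_left {m m' : M} (f : m ⟶ m') (P : LeftDualTriple B) :
    E.functor.map (f ⊵ᵣ P.obj) ≫ (E.rightComparisonIso m' P).hom =
      (E.rightComparisonIso m P).hom ≫ E.functor.map f ⊵ᵣ P.ddual :=
  E.hom_ext_actionRight _ fun x ξ => by
    rw [Category.assoc, Category.assoc, rightComparisonIso_hom_component, map_component,
      ← MonoidalRightAction.comp_actionHomLeft, map_component, rightComparisonIso_hom_component]
    exact congrArg _ (LinearMap.ext fun g => congrArg ξ (P.transpose_comp g f))

lemma rightComparisonIso_unit (m : M) :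
    (E.rightComparisonIso m (LeftDualTriple.unit B)).hom ≫ (ρᵣ[B] (E.functor.obj m)).hom =
      E.functor.map (ρᵣ[B] m).hom :=
  E.hom_ext_component fun x ξ => by
    rw [Category.assoc, MonoidalRightAction.actionUnitIso_hom_naturality,
      reassoc_of% rightComparisonIso_hom_component, map_component, component_naturality]
    refine congrArg _ (LinearMap.ext fun g => congrArg ξ ?_)
    exact (LeftDualTriple.transpose_unit ((ρᵣ[B] x).hom ≫ g)).trans (by simp)

/-- Coherence for the chosen duals `ᘁ(X ⊗ Y) = ᘁY ⊗ ᘁX`; other choices follow by naturality. -/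
lemma rightComparisonIso_tensor (m : M) (P Q : LeftDualTriple B) :
    (E.rightComparisonIso m (P.tensor Q)).hom ≫ (αᵣ (E.functor.obj m) P.ddual Q.ddual).hom =
      E.functor.map (αᵣ m P.obj Q.obj).hom ≫ (E.rightComparisonIso (m ⊙ᵣ P.obj) Q).hom ≫
        (E.rightComparisonIso m P).hom ⊵ᵣ Q.ddual :=
  E.hom_ext_actionRight_actionRight _ _ fun x ξ => by
    have h : (αᵣ (E.functor.obj m) P.ddual Q.ddual).hom ≫
        (E.component m x ξ ⊵ᵣ P.ddual) ⊵ᵣ Q.ddual =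
          E.component m x ξ ⊵ᵣ (P.ddual ⊗ Q.ddual) ≫ (αᵣ x P.ddual Q.ddual).hom := by
      simp [MonoidalRightAction.actionHomLeft_tensor]
    simp only [Category.assoc]
    rw [h, reassoc_of% rightComparisonIso_hom_component,
      ← MonoidalRightAction.comp_actionHomLeft, rightComparisonIso_hom_component,
      rightComparisonIso_hom_component, map_component, component_naturality]
    refine congrArg _ (LinearMap.ext fun g => congrArg ξ ?_)
    refine (LeftDualTriple.transpose_tensor P Q ((αᵣ x P.ddual Q.ddual).hom ≫ g)).trans ?_
    rw [Category.assoc, Iso.inv_hom_id_assoc]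
    rfl

/-- The structure of a module functor `N : M ⥤ Mᘁᘁ` on the Nakayama functor, where `b` acts on
`Mᘁᘁ` as `ᘁᘁb`. -/
@[reducible]
noncomputable def rightLinear (A : Type*) [Category* A] [MonoidalCategory A] :
    (E.functor ⋙ toTwist A B M).RightLinear B :=
  rightLinearOfIso (E.functor ⋙ toTwist A B M) B
    (fun m b => E.rightComparisonIso m (LeftDualTriple.of b))
    (fun m {b b'} f => E.rightComparisonIso_naturality_right m (LeftDualTriple.of b)
      (LeftDualTriple.of b') f)
    (fun f b => E.rightComparisonIso_naturality_left f (LeftDualTriple.of b))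
    (fun m a b => by
      -- The associator of the twisted action contains the constraint `ᘁᘁ(a ⊗ b) ≅ ᘁᘁa ⊗ ᘁᘁb`,
      -- which is the mate of the identity of `a ⊗ b` for the two choices of duals.
      have h := E.rightComparisonIso_naturality_right m (LeftDualTriple.of (a ⊗ b))
        ((LeftDualTriple.of a).tensor (LeftDualTriple.of b)) (𝟙 _)
      rw [MonoidalRightAction.actionHomRight_id, CategoryTheory.Functor.map_id,
        Category.id_comp] at h
      exact ((Category.assoc _ _ _).symm.trans (congrArg (· ≫ _) h.symm)).trans
        (E.rightComparisonIso_tensor m (LeftDualTriple.of a) (LeftDualTriple.of b)))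
    (fun m => by
      have h := E.rightComparisonIso_naturality_right m (LeftDualTriple.of (𝟙_ B))
        (LeftDualTriple.unit B) (𝟙 _)
      rw [MonoidalRightAction.actionHomRight_id, CategoryTheory.Functor.map_id,
        Category.id_comp] at h
      exact ((Category.assoc _ _ _).symm.trans (congrArg (· ≫ _) h.symm)).trans
        (E.rightComparisonIso_unit m))

end NakayamaEnds

end RightStructure


/-! ### The bimodule functor structure -/

section Projections

universe w v u

variable {k : Type w} [Field k] {M : Type u} [Category.{v} M] [Preadditive M] [Linear k M]
  [HasFiniteBiproducts M] [IsFiniteLinear k M]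

/-- The condition on components that characterizes a comparison morphism, restated for the
structure morphisms of the ends. -/
lemma NakayamaEnds.comp_map_proj (E : NakayamaEnds k M) (F : M ⥤ M) [F.Additive] [F.Linear k]
    {m n x : M} (φ : E.functor.obj n ⟶ F.obj (E.functor.obj m))
    (T : (F.obj x ⟶ n) →ₗ[k] (x ⟶ m))
    (h : ∀ ξ, φ ≫ F.map (E.component m x ξ) = E.component n (F.obj x) (ξ.comp T)) :
    φ ≫ F.map (E.proj m x) =
      E.proj n (F.obj x) ≫ copower.map T (𝟙 _) ≫ copower.comparison F (x ⟶ m) x :=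
  copower.hom_ext_map_eval F fun ξ => by
    have h₁ : F.map (E.component m x ξ) = F.map (E.proj m x) ≫ F.map (copower.eval ξ x) :=
      F.map_comp _ _
    have h₂ : (copower.map T (𝟙 (F.obj x)) ≫ copower.comparison F (x ⟶ m) x) ≫
        F.map (copower.eval ξ x) = copower.eval (ξ.comp T) (F.obj x) := by
      rw [Category.assoc, copower.comparison_map_eval, copower.map_eval, Category.comp_id]
    exact (Category.assoc _ _ _).trans ((congrArg (φ ≫ ·) h₁.symm).trans ((h ξ).trans
      ((congrArg (E.proj n (F.obj x) ≫ ·) h₂.symm).trans (Category.assoc _ _ _).symm)))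

end Projections

section BimoduleStructure

open BimoduleCategory

universe w v u

variable {k : Type w} [Field k] {A B : Type*} [Category* A] [Abelian A] [Linear k A]
  [MonoidalCategory A] [RightRigidCategory A] [Category* B] [Abelian B] [Linear k B]
  [MonoidalCategory B] [LeftRigidCategory B] {M : Type u} [Category.{v} M] [Preadditive M]
  [Linear k M] [HasFiniteBiproducts M] [IsFiniteLinear k M] [MonoidalLeftAction A M]
  [MonoidalRightAction B M] [BimoduleCategory A B M] [IsLinearLeftModule k A M]
  [IsLinearRightModule k B M]

namespace NakayamaEnds

variable (E : NakayamaEnds k M)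

lemma comparisonIso_mid (P : RightDualTriple A) (m : M) (Q : LeftDualTriple B) :
    E.functor.map (mid P.obj m Q.obj).hom ≫ (E.leftComparisonIso P (m ⊙ᵣ Q.obj)).hom ≫
        P.ddual ⊴ₗ (E.rightComparisonIso m Q).hom =
      (E.rightComparisonIso (P.obj ⊙ₗ m) Q).hom ≫ (E.leftComparisonIso P m).hom ⊵ᵣ Q.ddual ≫
        (mid P.ddual (E.functor.obj m) Q.ddual).hom :=
  E.hom_ext_actionRight_actionLeft _ _ fun x ξ => by
    simp only [Category.assoc]
    rw [← MonoidalLeftAction.actionHomRight_comp, rightComparisonIso_hom_component,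
      leftComparisonIso_hom_component, map_component, ← mid_naturality_middle,
      ← MonoidalRightAction.comp_actionHomLeft_assoc, leftComparisonIso_hom_component,
      reassoc_of% rightComparisonIso_hom_component, component_naturality]
    exact congrArg _ (LinearMap.ext fun g => congrArg ξ (transpose_mid P Q g))

/-- The structure of a bimodule functor on the Nakayama functor. -/
@[reducible]
noncomputable def bimoduleFunctor : BimoduleFunctor A B (E.functor ⋙ toTwist A B M) where
  toLeftLinear := E.leftLinear B
  toRightLinear := E.rightLinear A
  map_mid a m b :=
    E.comparisonIso_mid (RightDualTriple.of a) m (LeftDualTriple.of b)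

lemma isCanonical_bimoduleFunctor :
    letI := E.bimoduleFunctor (A := A) (B := B)
    IsCanonical (A := A) (B := B) E :=
  letI := E.bimoduleFunctor (A := A) (B := B)
  { left a m x :=
      have := IsLinearLeftModule.additive_left (k := k) (A := A) (M := M)
      have := IsLinearLeftModule.linear_left (k := k) (A := A) (M := M)
      E.comp_map_proj (MonoidalLeftAction.actionLeft M (RightDualTriple.of a).ddual)
        (E.leftComparisonIso (RightDualTriple.of a) m).hom (leftTranspose k a x m) fun ξ => by
          rw [leftTranspose_eq]
          exact E.leftComparisonIso_hom_component (RightDualTriple.of a) m x ξ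
    right m x b :=
      have := IsLinearRightModule.additive_right (k := k) (B := B) (M := M)
      have := IsLinearRightModule.linear_right (k := k) (B := B) (M := M)
      E.comp_map_proj (MonoidalRightAction.actionRight M (LeftDualTriple.of b).ddual)
        (E.rightComparisonIso m (LeftDualTriple.of b)).hom (rightTranspose k x m b) fun ξ => by
          rw [rightTranspose_eq]
          exact E.rightComparisonIso_hom_component (LeftDualTriple.of b) m x ξ }

end NakayamaEnds

end BimoduleStructure

end FinTensor

theorem theorem4p2 {k : Type*} [Field k] [IsAlgClosed k]
    {A : Type*} [Category* A] [Abelian A] [Linear k A] [MonoidalCategory A]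
    [MonoidalPreadditive A] [MonoidalLinear k A] [RigidCategory A]
    [FinTensor.IsFiniteTensorCategory k A]
    {B : Type*} [Category* B] [Abelian B] [Linear k B] [MonoidalCategory B]
    [MonoidalPreadditive B] [MonoidalLinear k B] [RigidCategory B]
    [FinTensor.IsFiniteTensorCategory k B]
    {M : Type*} [Category* M] [Abelian M] [Linear k M] [FinTensor.IsFiniteLinear k M]
    [MonoidalLeftAction A M] [MonoidalRightAction B M] [FinTensor.BimoduleCategory A B M]
    [FinTensor.IsLinearLeftModule k A M] [FinTensor.IsLinearRightModule k B M] :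
    Nonempty (FinTensor.NakayamaEnds k M) ∧
      ∀ E : FinTensor.NakayamaEnds k M,
        E.functor.Additive ∧ E.functor.Linear k ∧
          ∃ _ : FinTensor.BimoduleFunctor A B (E.functor ⋙ FinTensor.toTwist A B M),
            FinTensor.IsCanonical (A := A) (B := B) E :=
  ⟨FinTensor.nonempty_nakayamaEnds k M, fun E =>
    ⟨E.functor_additive, E.functor_linear, E.bimoduleFunctor, E.isCanonical_bimoduleFunctor⟩⟩
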